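/- Let $(K,*)$ be a commutative hypergroup: $K$ is a locally compact Hausdorff space with a bilinear, associative, weakly continuous convolution of bounded regular Borel measures such that 1. each $\delta_x*\delta_y$ is a probability measure with compact support; 2. $(x,y)\mapsto\operatorname{supp}(\delta_x*\delta_y)$ is continuous into the space of compact subsets of $K$ with the Michael topology; 3. there is an identity $e\in K$ with $\delta_e*\delta_x=\delta_x*\delta_e=\delta_x$; 4. there is a homeomorphic involution $x\mapsto x^\sim$ of $K$ with $(\delta_x*\delta_y)^\sim=\delta_{y^\sim}*\delta_{x^\sim}$ (where $\mu^\sim(B)=\mu(\{b^\sim: b\in B\})$), and $e\in\operatorname{supp}(\delta_x*\delta_y)$ if and only if $x=y^\sim$; 5. $\delta_x*\delta_y=\delta_y*\delta_x$ for all $x,y\in K$. (Weak continuity means joint continuity of the convolution on finite positive regular measures for the weak topology.) Put $T^xf(y)=\int_K f\,d(\delta_x*\delta_y)$, and let $\lambda$ be a Haar measure on $K$: a nonzero regular Borel measure with $\int_K T^xf\,d\lambda=\int_K f\,d\lambda$ for all $x\in K$ and all Borel $f\ge 0$. Let $\rho:K\times K\to[0,\infty)$ be a quasi-metric: $\rho(x,y)=0$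 if and only if $x=y$; $\rho(x,y)=\rho(y,x)$; and, for some $c\ge 1$, $\rho(x,y)\le c(\rho(x,z)+\rho(z,y))$ for all $x,y,z\in K$. Suppose all balls $B(x,r)=\{y:\rho(x,y)<r\}$ are $\lambda$-measurable and $\lambda$ is doubling: for some constant $D$, $0<\lambda B(x,2r)\le D\,\lambda B(x,r)<\infty$ for all $x\in K$, $r>0$. Suppose further that there are $N\in\mathbb R$ and constants $c_1,c_2,c_3>0$ such that for all $x,y\in K$ and $r>0$ $$\operatorname{supp}\bigl(z\mapsto T^x\chi_{B(e,r)}(z^\sim)\bigr)\subset B(x,c_1r),\qquad \lambda B(x,r)\,T^x\chi_{B(e,r)}(y^\sim)\le c_2\,\lambda B(e,r)\le c_3\,r^N .$$ If $0<\alpha<N$, $1<p<N/\alpha$ and $\frac1p-\frac1q=\frac\alpha N$, then the Riesz potential $$I_\alpha f(x)=\int_K (T^xk_\alpha)(y)\,f(y^\sim)\,d\lambda(y),\qquad k_\alpha(y)=\rho(e,y)^{\alpha-N},\quad k_\alpha(e)=\infty,$$ is a bounded operator from $L^p(K,\lambda)$ into $L^q(K,\lambda)$. Precisely, for every $x$ one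 has $T^xk_\alpha(y)<\infty$ for $\lambda$-almost every $y$, and there is a constant $C$ such that for every real-valued $f\in L^p(K,\lambda)$ the integral defining $I_\alpha f(x)$ converges absolutely for $\lambda$-almost every $x$, $I_\alpha f\in L^q(K,\lambda)$ and $\|I_\alpha f\|_{L^q}\le C\|f\|_{L^p}$. -/

import Mathlib

open MeasureTheory
open scoped ENNReal NNReal

noncomputable section

section RegularMeasures

variable (K : Type*) [TopologicalSpace K] [MeasurableSpace K]

/-- The cone of finite positive regular Borel measures on `K`. It carries the weak topology, i.e.
the topology induced by the maps `μ ↦ ∫ f dμ`, `f` bounded and continuous. -/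
abbrev PosRegularMeasure : Type _ := {μ : FiniteMeasure K // (μ : Measure K).Regular}

/-- The space of all bounded (signed) regular Borel measures on `K`: the linear combinations of
finite positive regular measures. -/
def RegularSignedMeasure : Submodule ℝ (SignedMeasure K) :=
  Submodule.span ℝ (Set.range fun μ : PosRegularMeasure K => (μ.1 : Measure K).toSignedMeasure)

variable {K}

/-- A finite positive regular measure, as a bounded regular signed measure. -/
def PosRegularMeasure.toSigned (μ : PosRegularMeasure K) : RegularSignedMeasure K :=
  ⟨(μ.1 : Measure K).toSignedMeasure, Submodule.subset_span ⟨μ, rfl⟩⟩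

theorem regular_dirac [T2Space K] [BorelSpace K] (x : K) : (Measure.dirac x).Regular where
  lt_top_of_isCompact := fun C _ => measure_lt_top _ C
  outerRegular := by
    intro A _ r hr
    by_cases hx : x ∈ A
    · refine ⟨Set.univ, Set.subset_univ _, isOpen_univ, ?_⟩
      simpa [Measure.dirac_apply_of_mem hx] using hr
    · refine ⟨{x}ᶜ, fun y hy hyx => hx (hyx ▸ hy), isOpen_compl_singleton, ?_⟩
      have h : Measure.dirac x ({x}ᶜ : Set K) = 0 := by simp
      rw [h]
      exact lt_of_le_of_lt (zero_le) hr
  innerRegular := by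
    intro U hU r hr
    have hx : x ∈ U := by
      by_contra hx
      simp [Measure.dirac_apply' x hU.measurableSet, hx] at hr
    refine ⟨{x}, Set.singleton_subset_iff.2 hx, isCompact_singleton, ?_⟩
    rw [Measure.dirac_apply_of_mem hx] at hr
    rwa [Measure.dirac_apply_of_mem (Set.mem_singleton x)]

/-- The point measure `δ_x`. -/
def pointMass [T2Space K] [BorelSpace K] (x : K) : PosRegularMeasure K :=
  ⟨⟨Measure.dirac x, inferInstance⟩, regular_dirac x⟩

end RegularMeasures

/-- A hypergroup `(K, *)`: a locally compact Hausdorff space `K` together with a bilinear,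
associative, weakly continuous convolution of bounded regular Borel measures. -/
structure Hypergroup (K : Type*) [TopologicalSpace K] [T2Space K] [LocallyCompactSpace K]
    [MeasurableSpace K] [BorelSpace K] where
  /-- the convolution, a bilinear operation on bounded regular Borel measures -/
  conv : RegularSignedMeasure K →ₗ[ℝ] RegularSignedMeasure K →ₗ[ℝ] RegularSignedMeasure K
  conv_assoc : ∀ μ ν τ, conv (conv μ ν) τ = conv μ (conv ν τ)
  /-- the restriction of the convolution to positive measures -/
  posConv : PosRegularMeasure K → PosRegularMeasure K → PosRegularMeasure K
  toSigned_posConv : ∀ μ ν, (posConv μ ν).toSigned = conv μ.toSigned ν.toSigned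
  /-- weak continuity -/
  continuous_posConv :
    Continuous fun m : PosRegularMeasure K × PosRegularMeasure K => posConv m.1 m.2
  /-- `δ_x * δ_y` is a probability measure with compact support -/
  isProbabilityMeasure_posConv : ∀ x y,
    IsProbabilityMeasure ((posConv (pointMass x) (pointMass y)).1 : Measure K)
  isCompact_support : ∀ x y,
    IsCompact ((posConv (pointMass x) (pointMass y)).1 : Measure K).support
  /-- `(x, y) ↦ supp (δ_x * δ_y)` is continuous into the space of compact subsets of `K`, which
  Mathlib endows with the Vietoris (= Michael) topology -/
  continuous_support : Continuous fun z : K × K =>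
    (⟨((posConv (pointMass z.1) (pointMass z.2)).1 : Measure K).support,
      isCompact_support z.1 z.2⟩ : TopologicalSpace.Compacts K)
  /-- the identity -/
  e : K
  pointMass_e_conv : ∀ x, posConv (pointMass e) (pointMass x) = pointMass x
  conv_pointMass_e : ∀ x, posConv (pointMass x) (pointMass e) = pointMass x
  /-- the involution `x ↦ x~` -/
  inv : K ≃ₜ K
  inv_inv : ∀ x, inv (inv x) = x
  /-- `(δ_x * δ_y)~ = δ_{y~} * δ_{x~}`, where `μ~ (B) = μ {x~ : x ∈ B}` -/
  inv_conv : ∀ x y (B : Set K), MeasurableSet B →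
    ((posConv (pointMass x) (pointMass y)).1 : Measure K) (inv '' B) =
      ((posConv (pointMass (inv y)) (pointMass (inv x))).1 : Measure K) B
  e_mem_support : ∀ x y,
    e ∈ ((posConv (pointMass x) (pointMass y)).1 : Measure K).support ↔ x = inv y

namespace Hypergroup

variable {K : Type*} [TopologicalSpace K] [T2Space K] [LocallyCompactSpace K]
  [MeasurableSpace K] [BorelSpace K] (H : Hypergroup K)

/-- The probability measure `δ_x * δ_y`. -/
def pointConv (x y : K) : Measure K := (H.posConv (pointMass x) (pointMass y)).1

/-- The hypergroup is commutative. -/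
def IsCommutative : Prop := ∀ x y, H.pointConv x y = H.pointConv y x

/-- The generalized translation `T^x f (y) = ∫ f d(δ_x * δ_y)` of a nonnegative function. -/
def translate (x : K) (f : K → ℝ≥0∞) (y : K) : ℝ≥0∞ := ∫⁻ z, f z ∂(H.pointConv x y)

/-- A Haar measure on a commutative hypergroup: a nonzero regular (Radon) Borel measure which is
invariant under the generalized translations. -/
structure IsHaar (lam : Measure K) : Prop where
  regular : lam.Regular
  ne_zero : lam ≠ 0
  lintegral_translate : ∀ (x : K) (f : K → ℝ≥0∞), Measurable f →
    ∫⁻ y, H.translate x f y ∂lam = ∫⁻ y, f y ∂lam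

end Hypergroup

/-- Quasi-metrics on a set. -/
structure IsQuasiMetric {K : Type*} (ρ : K → K → ℝ) : Prop where
  nonneg : ∀ x y, 0 ≤ ρ x y
  eq_zero_iff : ∀ x y, ρ x y = 0 ↔ x = y
  symm : ∀ x y, ρ x y = ρ y x
  quasi_triangle : ∃ c : ℝ, 1 ≤ c ∧ ∀ x y z, ρ x y ≤ c * (ρ x z + ρ z y)

/-- The ball `B(x, r) = {y : ρ(x, y) < r}`. -/
def quasiBall {K : Type*} (ρ : K → K → ℝ) (x : K) (r : ℝ) : Set K := {y | ρ x y < r}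

/-- Every ball is measurable for (the completion of) `lam`, and `lam` satisfies the doubling
condition `0 < λ B(x, 2r) ≤ D λ B(x, r) < ∞`. -/
structure IsDoublingMeasure {K : Type*} [MeasurableSpace K] (ρ : K → K → ℝ) (lam : Measure K) :
    Prop where
  nullMeasurableSet_ball : ∀ x r, NullMeasurableSet (quasiBall ρ x r) lam
  doubling : ∃ D : ℝ≥0, ∀ (x : K) (r : ℝ), 0 < r →
    0 < lam (quasiBall ρ x (2 * r)) ∧
    lam (quasiBall ρ x (2 * r)) ≤ D * lam (quasiBall ρ x r) ∧
    D * lam (quasiBall ρ x r) < ∞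

namespace Hypergroup

variable {K : Type*} [TopologicalSpace K] [T2Space K] [LocallyCompactSpace K]
  [MeasurableSpace K] [BorelSpace K] (H : Hypergroup K)

/-- `Λ_x (y) = T^x χ_{B(e, r)} (y~)`. -/
def ballTranslate (ρ : K → K → ℝ) (r : ℝ) (x y : K) : ℝ≥0∞ :=
  H.translate x ((quasiBall ρ H.e r).indicator fun _ => 1) (H.inv y)

/-- The support condition: `supp Λ_x ⊆ B(x, c₁ r)`. -/
def SupportCondition (ρ : K → K → ℝ) : Prop :=
  ∃ c₁ : ℝ, 0 < c₁ ∧ ∀ (x : K) (r : ℝ), 0 < r →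
    tsupport (H.ballTranslate ρ r x) ⊆ quasiBall ρ x (c₁ * r)

/-- The growth condition: `λ B(x, r) T^x χ_{B(e, r)} (y~) ≤ c₂ λ B(e, r) ≤ c₃ r ^ N`. -/
def GrowthCondition (ρ : K → K → ℝ) (lam : Measure K) (N : ℝ) : Prop :=
  ∃ c₂ c₃ : ℝ≥0, 0 < c₂ ∧ 0 < c₃ ∧ ∀ (x y : K) (r : ℝ), 0 < r →
    lam (quasiBall ρ x r) * H.ballTranslate ρ r x y ≤ c₂ * lam (quasiBall ρ H.e r) ∧
    c₂ * lam (quasiBall ρ H.e r) ≤ c₃ * ENNReal.ofReal (r ^ N)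

/-- The kernel `y ↦ ρ(e, y) ^ (α - N)`; for `α < N` it equals `∞` at `y = e`. -/
def rieszKernel (ρ : K → K → ℝ) (N α : ℝ) (y : K) : ℝ≥0∞ :=
  ENNReal.ofReal (ρ H.e y) ^ (α - N)

/-- The Riesz potential `I_α f (x) = ∫ T^x ρ(e, y) ^ (α - N) f(y~) dλ(y)`. -/
def rieszPotential (ρ : K → K → ℝ) (lam : Measure K) (N α : ℝ) (f : K → ℝ) (x : K) : ℝ :=
  ∫ y, (H.translate x (H.rieszKernel ρ N α) y).toReal * f (H.inv y) ∂lam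

end Hypergroup

end

open MeasureTheory Filter Topology Set Function
open scoped ENNReal NNReal

/-! The argument is Hedberg's. Cutting `k_α` at dyadic radii around `e` dominates `|I_α f|` by the
sum over `j` of `2 ^ ((j - 1)(α - N))` times the convolution of `χ_{B(e, 2^j)}` with `|f|`. Since `λ
B(e, r) ≲ r ^ N`, the `j`-th term is at most a constant times `2 ^ (jα) Mf(x)`, where `M` is the
maximal function over normalized balls at `e`, and, by Hölder, at most a constant times `2 ^ (-j(N/p
- α)) ‖f‖_p`. The two geometric bounds cross at one scale, so the sum is `≲ Mf(x) ^ (p/q) ‖f‖_p ^ (1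
- p/q)` (`exists_tsum_int_min_le`). Taking `q`-th powers and integrating leaves the `L^p` bound for
`M` (`exists_lintegral_dyadicMaximal_rpow_le`).

For that bound, the support and growth conditions dominate each average by a mean over `B(x, c₁ r)`.
Vitali covering and doubling give a weak type inequality, and truncating `f` at height `t / 2` turns
it into a strong one.

Two further points need care. The involution occurs in `I_α`, so `λ(E~) ≤ C λ(E)` is required;
`exists_map_inv_le` obtains it by Tonelli on a pair of concentric balls. Also, `K` need not be
second countable and balls are only `λ`-measurable. Hence translates are replaced by versions a.e.
measurable on the product (`exists_aemeasurable_prod_translate`), and `λ`-null sets are shown to be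
null for `δ_x * δ_y`, for a.e. `y` (`ae_pointConv_eq_zero`). -/

/-! ### Urysohn cutoffs. -/

theorem exists_continuous_nnreal_between {K : Type*} [TopologicalSpace K] [T2Space K]
    [LocallyCompactSpace K] {L U : Set K} (hL : IsCompact L) (hU : IsOpen U)
    (hLU : L ⊆ U) : ∃ g : K → ℝ≥0, Continuous g ∧ (∀ x, g x ≤ 1) ∧ (∀ x ∈ L, g x = 1) ∧
      (∀ x ∉ U, g x = 0) ∧ HasCompactSupport g := by
  obtain ⟨f, hf1, hf0, hfc, hf⟩ := exists_continuous_one_zero_of_isCompact hL hU.isClosed_compl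
    (disjoint_compl_right_iff_subset.2 hLU)
  refine ⟨fun x => (f x).toNNReal, continuous_real_toNNReal.comp f.continuous, fun x => ?_,
    fun x hx => ?_, fun x hx => ?_, ?_⟩
  · simpa using (hf x).2
  · simp [hf1 hx]
  · simp [hf0 hx]
  · exact hfc.comp_left Real.toNNReal_zero

theorem indicator_one_le_of_eq_one {K : Type*} {L : Set K} {g : K → ℝ≥0}
    (h : ∀ x ∈ L, g x = 1) (x : K) :
    L.indicator (fun _ => (1 : ℝ≥0∞)) x ≤ g x := by
  by_cases hx : x ∈ L <;> simp [hx, h]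

theorem le_indicator_one_of_eq_zero {K : Type*} {U : Set K} {g : K → ℝ≥0} (h1 : ∀ x, g x ≤ 1)
    (h : ∀ x ∉ U, g x = 0) (x : K) : (g x : ℝ≥0∞) ≤ U.indicator (fun _ => (1 : ℝ≥0∞)) x := by
  by_cases hx : x ∈ U
  · simpa [hx] using h1 x
  · simp [hx, h]

/-! ### The measures `δ_x * δ_y`: measurability, involution, null sets. -/

namespace Hypergroup

variable {K : Type*} [TopologicalSpace K] [T2Space K] [LocallyCompactSpace K]
  [MeasurableSpace K] [BorelSpace K] (H : Hypergroup K)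

theorem continuous_pointMass {K : Type*} [TopologicalSpace K] [T2Space K] [MeasurableSpace K]
    [BorelSpace K] : Continuous (pointMass : K → PosRegularMeasure K) := by
  refine continuous_induced_rng.2 (FiniteMeasure.continuous_iff_forall_continuous_lintegral.2 ?_)
  intro f
  have h : ∀ x : K, ∫⁻ y, (f y : ℝ≥0∞) ∂(Measure.dirac x) = f x := fun x =>
    lintegral_dirac' x (measurable_coe_nnreal_ennreal.comp f.continuous.measurable)
  refine Continuous.congr ?_ fun x => (h x).symm
  exact ENNReal.continuous_coe.comp f.continuous

instance (x y : K) : IsProbabilityMeasure (H.pointConv x y) :=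
  H.isProbabilityMeasure_posConv x y

theorem regular_pointConv (x y : K) : (H.pointConv x y).Regular :=
  (H.posConv (pointMass x) (pointMass y)).2

theorem continuous_lintegral_pointConv {g : K → ℝ≥0} (hg : Continuous g) (hg1 : ∀ x, g x ≤ 1) :
    Continuous fun z : K × K => ∫⁻ w, (g w : ℝ≥0∞) ∂(H.pointConv z.1 z.2) := by
  let G : BoundedContinuousFunction K ℝ≥0 :=
    BoundedContinuousFunction.mkOfBound ⟨g, hg⟩ 1 fun x y => by
      rw [ContinuousMap.coe_mk, NNReal.dist_eq, abs_sub_le_iff]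
      have hx : (g x : ℝ) ≤ 1 := hg1 x
      have hy : (g y : ℝ) ≤ 1 := hg1 y
      constructor <;> linarith [(g x).2, (g y).2]
  have hc : Continuous fun z : K × K =>
      (H.posConv (pointMass z.1) (pointMass z.2)).1 :=
    continuous_subtype_val.comp (H.continuous_posConv.comp
      ((continuous_pointMass.comp continuous_fst).prodMk
        (continuous_pointMass.comp continuous_snd)))
  exact (FiniteMeasure.continuous_iff_forall_continuous_lintegral.1 hc) G

theorem lintegral_pointConv_ne_top {g : K → ℝ≥0} (hg1 : ∀ x, g x ≤ 1) (x y : K) :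
    ∫⁻ w, (g w : ℝ≥0∞) ∂(H.pointConv x y) ≠ ∞ := by
  refine ne_top_of_le_ne_top ENNReal.one_ne_top
    ((lintegral_mono fun w => ENNReal.coe_le_one_iff.2 (hg1 w)).trans ?_)
  simp

/-- By inner regularity, a continuous cutoff `g ≤ χ_U` already has integral above `t`, and that
integral varies continuously. Open sets form a generating π-system, so this yields measurability of
the kernel. -/
theorem lowerSemicontinuous_pointConv {U : Set K} (hU : IsOpen U) :
    LowerSemicontinuous fun z : K × K => H.pointConv z.1 z.2 U := by
  intro z t ht
  have := H.regular_pointConv z.1 z.2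
  obtain ⟨L, hLU, hL, hLt⟩ := hU.exists_lt_isCompact ht
  obtain ⟨g, hg, hg1, hgL, hgU, -⟩ := exists_continuous_nnreal_between hL hU hLU
  have h1 : t < ∫⁻ w, (g w : ℝ≥0∞) ∂(H.pointConv z.1 z.2) := by
    refine hLt.trans_le ?_
    rw [← lintegral_indicator_one hL.measurableSet]
    exact lintegral_mono (indicator_one_le_of_eq_one hgL)
  filter_upwards [(H.continuous_lintegral_pointConv hg hg1).continuousAt.eventually_const_lt h1]
    with z' hz'
  refine hz'.trans_le ?_
  rw [← lintegral_indicator_one hU.measurableSet]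
  exact lintegral_mono (le_indicator_one_of_eq_zero hg1 hgU)

theorem measurable_pointConv (x : K) : Measurable fun y => H.pointConv x y :=
  Measurable.measure_of_isPiSystem_of_isProbabilityMeasure
    (BorelSpace.measurable_eq (α := K)) isPiSystem_isOpen fun _ hU =>
      LowerSemicontinuous.measurable fun y t ht =>
        (Continuous.prodMk_right x).continuousAt.eventually
          (H.lowerSemicontinuous_pointConv hU (x, y) t ht)

theorem measurable_translate (x : K) {f : K → ℝ≥0∞} (hf : Measurable f) :
    Measurable (H.translate x f) :=
  (Measure.measurable_lintegral hf).comp (H.measurable_pointConv x)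

/-- Commutativity puts the factors back in order after the involution has reversed them. Thus `y ↦
T^x f(y~)` is itself a translate, by `x~`, of `f ∘ ~`. -/
theorem pointConv_inv_right (hcomm : H.IsCommutative) (x y : K) :
    H.pointConv x (H.inv y) = (H.pointConv (H.inv x) y).map H.inv := by
  ext B hB
  have hinv : ∀ C : Set K, H.inv '' C = H.inv ⁻¹' C := fun C =>
    congrFun (Set.image_eq_preimage_of_inverse H.inv_inv H.inv_inv) C
  rw [Measure.map_apply H.inv.continuous.measurable hB, ← hinv, hcomm (H.inv x) y]
  have := H.inv_conv y (H.inv x) B hB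
  rw [H.inv_inv] at this
  exact this.symm

theorem translate_inv_right (hcomm : H.IsCommutative) (x y : K) (f : K → ℝ≥0∞) :
    H.translate x f (H.inv y) = H.translate (H.inv x) (fun z => f (H.inv z)) y := by
  rw [translate, translate, H.pointConv_inv_right hcomm]
  exact lintegral_map_equiv f H.inv.toMeasurableEquiv

variable {H} {lam : Measure K}

/-- Invariance of `λ`, applied to the indicator of a measurable hull of `Z`, makes `∫ (δ_x *
δ_y)(hull) dλ(y)` vanish. This allows functions to be changed on null sets before they are
translated. -/
theorem IsHaar.ae_pointConv_eq_zero (hlam : H.IsHaar lam) {Z : Set K} (hZ : lam Z = 0) (x : K) :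
    ∀ᵐ y ∂lam, H.pointConv x y Z = 0 := by
  have h := hlam.lintegral_translate x ((toMeasurable lam Z).indicator 1)
    (measurable_one.indicator (measurableSet_toMeasurable _ _))
  rw [lintegral_indicator_one (measurableSet_toMeasurable _ _), measure_toMeasurable, hZ,
    lintegral_eq_zero_iff (H.measurable_translate x
      (measurable_one.indicator (measurableSet_toMeasurable _ _)))] at h
  filter_upwards [h] with y hy
  rw [translate, lintegral_indicator_one (measurableSet_toMeasurable _ _)] at hy
  exact measure_mono_null (subset_toMeasurable _ _) hy

theorem IsHaar.ae_ae_pointConv (hlam : H.IsHaar lam) {P : K → Prop} (hP : ∀ᵐ z ∂lam, P z) (x : K) :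
    ∀ᵐ y ∂lam, ∀ᵐ z ∂(H.pointConv x y), P z :=
  hlam.ae_pointConv_eq_zero hP x

theorem IsHaar.translate_congr_ae (hlam : H.IsHaar lam) {f g : K → ℝ≥0∞} (h : f =ᵐ[lam] g) (x : K) :
    H.translate x f =ᵐ[lam] H.translate x g := by
  filter_upwards [hlam.ae_ae_pointConv h x] with y hy using lintegral_congr_ae hy

theorem IsHaar.aemeasurable_translate (hlam : H.IsHaar lam) {f : K → ℝ≥0∞} (hf : AEMeasurable f lam)
    (x : K) : AEMeasurable (H.translate x f) lam :=
  ⟨_, H.measurable_translate x hf.measurable_mk, hlam.translate_congr_ae hf.ae_eq_mk x⟩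

theorem IsHaar.lintegral_translate_ae (hlam : H.IsHaar lam) {f : K → ℝ≥0∞}
    (hf : AEMeasurable f lam) (x : K) : ∫⁻ y, H.translate x f y ∂lam = ∫⁻ y, f y ∂lam := by
  rw [lintegral_congr_ae (hlam.translate_congr_ae hf.ae_eq_mk x),
    hlam.lintegral_translate x _ hf.measurable_mk, lintegral_congr_ae hf.ae_eq_mk]

end Hypergroup

/-! ### Almost everywhere measurability of continuous functions on the product. -/

section SigmaCompact

variable {K : Type*} [TopologicalSpace K] [T2Space K]
  [MeasurableSpace K] [BorelSpace K]

/-- A σ-finite regular measure is concentrated on an increasing union of compact sets. -/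
theorem exists_monotone_isCompact_ae_mem (μ : Measure K) [μ.Regular] [SigmaFinite μ] :
    ∃ C : ℕ → Set K, (∀ n, IsCompact (C n)) ∧ Monotone C ∧ ∀ᵐ x ∂μ, ∃ n, x ∈ C n := by
  have h : ∀ n m : ℕ, ∃ L ⊆ spanningSets μ n, IsCompact L ∧
      μ (spanningSets μ n \ L) < ((m : ℝ≥0∞) + 1)⁻¹ := fun n m =>
    (measurableSet_spanningSets μ n).exists_isCompact_sdiff_lt
      (measure_spanningSets_lt_top μ n).ne (by simp)
  choose L hLs hLc hL using h
  refine ⟨fun k => ⋃ n ≤ k, ⋃ m ≤ k, L n m, fun k => ?_, fun a b hab => ?_, ?_⟩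
  · exact (Set.finite_le_nat k).isCompact_biUnion fun n _ =>
      (Set.finite_le_nat k).isCompact_biUnion fun m _ => hLc n m
  · refine iUnion_mono fun n => iUnion_mono' fun hn => ⟨hn.trans hab, ?_⟩
    exact iUnion_mono fun m => iUnion_mono' fun hm => ⟨hm.trans hab, le_rfl⟩
  · have h0 : ∀ n, μ (spanningSets μ n \ ⋃ m, L n m) = 0 := by
      intro n
      have hle : ∀ m : ℕ, μ (spanningSets μ n \ ⋃ m, L n m) ≤ ((m : ℝ≥0∞) + 1)⁻¹ := fun m =>
        (measure_mono (sdiff_subset_sdiff_right (subset_iUnion (L n) m))).trans (hL n m).le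
      have ht : Tendsto (fun m : ℕ => ((m : ℝ≥0∞) + 1)⁻¹) atTop (𝓝 0) := by
        simpa using (tendsto_add_atTop_iff_nat 1).2 ENNReal.tendsto_inv_nat_nhds_zero
      exact le_antisymm (ge_of_tendsto' ht hle) zero_le
    have h1 : ∀ᵐ x ∂μ, ∀ n, x ∉ spanningSets μ n \ ⋃ m, L n m :=
      ae_all_iff.2 fun n => measure_eq_zero_iff_ae_notMem.1 (h0 n)
    filter_upwards [h1] with x hx
    obtain ⟨n, hn⟩ := mem_iUnion.1 ((iUnion_spanningSets μ).symm ▸ mem_univ x)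
    have hx' : x ∈ ⋃ m, L n m := by
      by_contra hc
      exact hx n ⟨hn, hc⟩
    obtain ⟨m, hm⟩ := mem_iUnion.1 hx'
    refine ⟨max n m, ?_⟩
    simp only [mem_iUnion]
    exact ⟨n, le_max_left _ _, m, le_max_right _ _, hm⟩

/-- Without second countability, a continuous function on the product need not be measurable for
the product σ-algebra, but it is almost everywhere measurable for products of Radon measures. -/
theorem Continuous.aemeasurable_prod [LocallyCompactSpace K] {μ : Measure K} [μ.Regular]
    [SigmaFinite μ] {F : K × K → ℝ≥0∞} (hF : Continuous F) (hfin : ∀ z, F z ≠ ∞) : AEMeasurable F (μ.prod μ) := by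
  obtain ⟨C, hC, hCm, hCae⟩ := exists_monotone_isCompact_ae_mem μ
  have hφ : ∀ n, ∃ g : K → ℝ≥0, Continuous g ∧ (∀ x, g x ≤ 1) ∧ (∀ x ∈ C n, g x = 1) ∧
      (∀ x ∉ (univ : Set K), g x = 0) ∧ HasCompactSupport g := fun n =>
    exists_continuous_nnreal_between (hC n) isOpen_univ (subset_univ _)
  choose φ hφc _ hφC _ hφs using hφ
  have hFc : Continuous fun z => (F z).toNNReal :=
    ENNReal.continuousOn_toNNReal.comp_continuous hF hfin
  -- The cutoffs give compact support, and a continuous compactly supported function is measurable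
  -- for the product σ-algebra. Almost every point lies in some `C n ×ˢ C n`, from which index on
  -- the truncation is exact.
  have hmeas : ∀ n, Measurable fun z : K × K => (F z).toNNReal * (φ n z.1 * φ n z.2) := by
    intro n
    refine (HasCompactSupport.stronglyMeasurable_of_prod (hFc.mul (((hφc n).comp
      continuous_fst).mul ((hφc n).comp continuous_snd))) ?_).measurable
    refine HasCompactSupport.intro ((hφs n).prod (hφs n)) fun z hz => ?_
    rw [mem_prod, not_and_or] at hz
    rcases hz with hz | hz <;> simp [image_eq_zero_of_notMem_tsupport hz]
  have hae : ∀ᵐ z ∂(μ.prod μ), ∃ n, z.1 ∈ C n ∧ z.2 ∈ C n := by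
    filter_upwards [Measure.quasiMeasurePreserving_fst.ae hCae,
      Measure.quasiMeasurePreserving_snd.ae hCae] with z h1 h2
    obtain ⟨n, hn⟩ := h1
    obtain ⟨m, hm⟩ := h2
    exact ⟨max n m, hCm (le_max_left _ _) hn, hCm (le_max_right _ _) hm⟩
  have hlim : AEMeasurable (fun z => (F z).toNNReal) (μ.prod μ) := by
    refine aemeasurable_of_tendsto_metrizable_ae atTop (fun n => (hmeas n).aemeasurable) ?_
    filter_upwards [hae] with z hz
    obtain ⟨n, h1, h2⟩ := hz
    refine tendsto_const_nhds.congr' ?_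
    filter_upwards [eventually_ge_atTop n] with m hm
    simp [hφC m _ (hCm hm h1), hφC m _ (hCm hm h2)]
  exact hlim.coe_nnreal_ennreal.congr (Eventually.of_forall fun z => ENNReal.coe_toNNReal (hfin z))

end SigmaCompact

/-! ### Joint measurability of translates. -/

namespace Hypergroup

variable {K : Type*} [TopologicalSpace K] [T2Space K] [LocallyCompactSpace K]
  [MeasurableSpace K] [BorelSpace K] {H : Hypergroup K} {lam : Measure K}

/-- `g n` can differ from the indicator only on `U n \ L n`. These sets have summable measure, so
Borel–Cantelli applies. -/
theorem exists_seq_continuous_tendsto_ae_indicator [lam.Regular] {E : Set K}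
    (hE : MeasurableSet E) (hEfin : lam E < ∞) :
    ∃ g : ℕ → K → ℝ≥0, (∀ n, Continuous (g n)) ∧ (∀ n x, g n x ≤ 1) ∧
      ∀ᵐ x ∂lam, Tendsto (fun n => (g n x : ℝ≥0∞)) atTop (𝓝 (E.indicator 1 x)) := by
  have h : ∀ n : ℕ, ∃ L U : Set K, L ⊆ E ∧ E ⊆ U ∧ IsCompact L ∧ IsOpen U ∧
      lam (U \ L) ≤ (2⁻¹ : ℝ≥0∞) ^ n + 2⁻¹ ^ n := by
    intro n
    have hn : (2⁻¹ : ℝ≥0∞) ^ n ≠ 0 := by simp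
    obtain ⟨U, hEU, hU, -, hUE⟩ := hE.exists_isOpen_sdiff_lt hEfin.ne hn
    obtain ⟨L, hLE, hL, hEL⟩ := hE.exists_isCompact_sdiff_lt hEfin.ne hn
    refine ⟨L, U, hLE, hEU, hL, hU, (measure_mono ?_).trans
      ((measure_union_le (U \ E) (E \ L)).trans (add_le_add hUE.le hEL.le))⟩
    intro x hx
    by_cases hxE : x ∈ E
    · exact Or.inr ⟨hxE, hx.2⟩
    · exact Or.inl ⟨hx.1, hxE⟩
  choose L U hLE hEU hL hU hUL using h
  choose g hgc hg1 hgL hgU _ using fun n =>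
    exists_continuous_nnreal_between (hL n) (hU n) ((hLE n).trans (hEU n))
  refine ⟨g, hgc, hg1, ?_⟩
  have hsum : ∑' n, lam (U n \ L n) ≠ ∞ := by
    refine ne_top_of_le_ne_top ?_ (ENNReal.tsum_le_tsum hUL)
    rw [ENNReal.tsum_add, ENNReal.tsum_geometric]
    simp
  filter_upwards [ae_eventually_notMem hsum] with x hx
  refine tendsto_const_nhds.congr' ?_
  filter_upwards [hx] with n hn
  by_cases hxE : x ∈ E
  · have : x ∈ L n := by
      by_contra hc
      exact hn ⟨hEU n hxE, hc⟩
    simp [hxE, hgL n x this]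
  · have : x ∉ U n := fun hc => hn ⟨hc, fun hl => hxE (hLE n hl)⟩
    simp [hxE, hgU n x this]

/-- The generalized translation as a function of two variables coincides, for every `x` and almost
every `y`, with a function which is almost everywhere measurable for the product measure. -/
theorem IsHaar.exists_aemeasurable_prod_translate [SigmaFinite lam] (hlam : H.IsHaar lam)
    {w : K → ℝ≥0∞} (hw : Measurable w) :
    ∃ h : K × K → ℝ≥0∞, AEMeasurable h (lam.prod lam) ∧
      ∀ x, H.translate x w =ᵐ[lam] fun y => h (x, y) := by
  have := hlam.regular
  refine Measurable.ennreal_sigmaFinite_induction (μ := lam) (motive := fun w =>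
    ∃ h : K × K → ℝ≥0∞, AEMeasurable h (lam.prod lam) ∧
      ∀ x, H.translate x w =ᵐ[lam] fun y => h (x, y)) ?_ ?_ ?_ hw
  · intro c s hs hsfin
    obtain ⟨g, hgc, hg1, hg⟩ := exists_seq_continuous_tendsto_ae_indicator hs hsfin
    have hmeas : ∀ n, AEMeasurable (fun z : K × K => ∫⁻ w, (g n w : ℝ≥0∞) ∂(H.pointConv z.1 z.2))
        (lam.prod lam) := fun n =>
      Continuous.aemeasurable_prod (H.continuous_lintegral_pointConv (hgc n) (hg1 n)) fun z =>
        H.lintegral_pointConv_ne_top (hg1 n) z.1 z.2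
    -- An upper limit is defined at every point and keeps a.e. measurability on the product; for
    -- each `x` it is a genuine limit for a.e. `y`.
    refine ⟨fun z => c * ⨅ n, ⨆ i, ∫⁻ w, (g (i + n) w : ℝ≥0∞) ∂(H.pointConv z.1 z.2),
      (AEMeasurable.iInf fun n => AEMeasurable.iSup fun i => hmeas (i + n)).const_mul c,
      fun x => ?_⟩
    · filter_upwards [hlam.ae_ae_pointConv hg x] with y hy
      have h1 : Tendsto (fun n => ∫⁻ w, (g n w : ℝ≥0∞) ∂(H.pointConv x y)) atTop
          (𝓝 (∫⁻ w, s.indicator 1 w ∂(H.pointConv x y))) :=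
        tendsto_lintegral_of_dominated_convergence (fun _ => 1)
          (fun n => ((hgc n).measurable).coe_nnreal_ennreal)
          (fun n => Eventually.of_forall fun w => ENNReal.coe_le_one_iff.2 (hg1 n w))
          (by simp) hy
      have h2 := h1.limsup_eq
      rw [limsup_eq_iInf_iSup_of_nat'] at h2
      rw [h2, lintegral_indicator_one hs, translate, lintegral_indicator_const hs]
  · intro f g _ hf _ ihf ihg
    obtain ⟨a, ha, ha'⟩ := ihf
    obtain ⟨b, hb, hb'⟩ := ihg
    refine ⟨a + b, ha.add hb, fun x => ?_⟩
    filter_upwards [ha' x, hb' x] with y h1 h2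
    rw [Pi.add_apply, ← h1, ← h2]
    exact lintegral_add_left hf _
  · intro f hf hmono ih
    choose a ha ha' using ih
    refine ⟨fun z => ⨆ n, a n z, AEMeasurable.iSup ha, fun x => ?_⟩
    filter_upwards [ae_all_iff.2 fun n => ha' n x] with y hy
    simp only [← hy]
    exact lintegral_iSup hf hmono

end Hypergroup

/-! ### Quasi-metric balls and doubling. -/

section QuasiMetric

variable {K : Type*} {ρ : K → K → ℝ}

theorem quasiBall_mono {x : K} {r s : ℝ} (h : r ≤ s) : quasiBall ρ x r ⊆ quasiBall ρ x s :=
  fun _ hy => lt_of_lt_of_le hy h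

theorem IsQuasiMetric.mem_quasiBall_self (hρ : IsQuasiMetric ρ) (x : K) {r : ℝ} (hr : 0 < r) :
    x ∈ quasiBall ρ x r := by
  have : ρ x x = 0 := (hρ.eq_zero_iff x x).2 rfl
  simpa [quasiBall, this] using hr

variable [MeasurableSpace K] {lam : Measure K}

theorem IsDoublingMeasure.measure_pos (h : IsDoublingMeasure ρ lam) (x : K) {r : ℝ} (hr : 0 < r) :
    0 < lam (quasiBall ρ x r) := by
  obtain ⟨D, hD⟩ := h.doubling
  have := (hD x (r / 2) (by positivity)).1
  rwa [mul_div_cancel₀ r two_ne_zero] at this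

theorem IsDoublingMeasure.measure_lt_top (h : IsDoublingMeasure ρ lam) (x : K) (r : ℝ) :
    lam (quasiBall ρ x r) < ∞ := by
  obtain ⟨D, hD⟩ := h.doubling
  have hr : (0 : ℝ) < max r 1 / 2 := by positivity
  refine (measure_mono (quasiBall_mono (le_max_left r 1))).trans_lt ?_
  have := (hD x (max r 1 / 2) hr).2.1.trans_lt (hD x (max r 1 / 2) hr).2.2
  rwa [mul_div_cancel₀ _ two_ne_zero] at this

theorem IsDoublingMeasure.exists_measure_mul_le (h : IsDoublingMeasure ρ lam) (M : ℝ) :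
    ∃ C : ℝ≥0, ∀ (x : K) (r : ℝ), 0 < r →
      lam (quasiBall ρ x (M * r)) ≤ C * lam (quasiBall ρ x r) := by
  obtain ⟨D, hD⟩ := h.doubling
  have hpow : ∀ (k : ℕ) (x : K) (r : ℝ), 0 < r →
      lam (quasiBall ρ x (2 ^ k * r)) ≤ (D ^ k : ℝ≥0) * lam (quasiBall ρ x r) := by
    intro k
    induction k with
    | zero => intro x r _; simp
    | succ k ih =>
      intro x r hr
      have h1 := (hD x (2 ^ k * r) (by positivity)).2.1
      rw [pow_succ', mul_assoc, pow_succ', ENNReal.coe_mul, mul_assoc]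
      exact h1.trans (mul_le_mul_right (ih x r hr) _)
  obtain ⟨k, hk⟩ := pow_unbounded_of_one_lt M (one_lt_two (α := ℝ))
  exact ⟨D ^ k, fun x r hr => (measure_mono (quasiBall_mono
    (mul_le_mul_of_nonneg_right hk.le hr.le))).trans (hpow k x r hr)⟩

theorem IsDoublingMeasure.sigmaFinite (h : IsDoublingMeasure ρ lam) [Nonempty K] :
    SigmaFinite lam := by
  obtain ⟨x⟩ := ‹Nonempty K›
  refine ⟨⟨⟨fun n => quasiBall ρ x n, fun _ => mem_univ _, fun n => h.measure_lt_top x n, ?_⟩⟩⟩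
  refine eq_univ_of_forall fun y => mem_iUnion.2 ?_
  exact exists_nat_gt (ρ x y)

end QuasiMetric

/-! ### Comparison of Haar measure with its image under the involution. -/

namespace Hypergroup

variable {K : Type*} [TopologicalSpace K] [T2Space K] [LocallyCompactSpace K]
  [MeasurableSpace K] [BorelSpace K] {H : Hypergroup K} {lam : Measure K}

theorem IsHaar.lintegral_translate_inv (hcomm : H.IsCommutative) (hlam : H.IsHaar lam) {E : Set K}
    (hE : MeasurableSet E) (x : K) :
    ∫⁻ y, H.translate x (E.indicator 1) (H.inv y) ∂lam = lam.map H.inv E := by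
  simp only [H.translate_inv_right hcomm]
  have hm : Measurable fun z => E.indicator (1 : K → ℝ≥0∞) (H.inv z) :=
    (measurable_one.indicator hE).comp H.inv.continuous.measurable
  rw [hlam.lintegral_translate _ _ hm, Measure.map_apply H.inv.continuous.measurable hE,
    ← lintegral_indicator_one (H.inv.continuous.measurable hE)]
  rfl

/-- A jointly measurable majorant of the translates of the indicator of a compact set. -/
theorem IsHaar.exists_aemeasurable_majorant [SigmaFinite lam] (hcomm : H.IsCommutative)
    (hlam : H.IsHaar lam) {E : Set K} (hE : IsCompact E) :
    ∃ F : K × K → ℝ≥0∞, AEMeasurable F (lam.prod lam) ∧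
      (∀ x y, H.translate x (E.indicator 1) (H.inv y) ≤ F (x, y)) ∧
      ∀ y, ∫⁻ x, F (x, y) ∂lam ≤ lam E := by
  have := hlam.regular
  have h : ∀ n : ℕ, ∃ U ⊇ E, IsOpen U ∧ lam U < lam E + ((n : ℝ≥0∞) + 1)⁻¹ := fun n =>
    E.exists_isOpen_lt_add hE.measure_lt_top.ne (by simp)
  choose U hEU hU hlU using h
  choose g hgc hg1 hgE hgU _ using fun n => exists_continuous_nnreal_between hE (hU n) (hEU n)
  have hcont : ∀ n, Continuous fun z : K × K =>
      ∫⁻ w, (g n w : ℝ≥0∞) ∂(H.pointConv z.1 (H.inv z.2)) := fun n =>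
    (H.continuous_lintegral_pointConv (hgc n) (hg1 n)).comp
      (continuous_fst.prodMk (H.inv.continuous.comp continuous_snd))
  -- Each integrand is continuous in both variables. For fixed `y`, commutativity makes it a
  -- translate by `y~`, so its integral in `x` is at most `λ(U n)`, which tends to `λ(E)`.
  refine ⟨fun z => ⨅ n, ∫⁻ w, (g n w : ℝ≥0∞) ∂(H.pointConv z.1 (H.inv z.2)),
    AEMeasurable.iInf fun n => (hcont n).aemeasurable_prod fun z =>
      H.lintegral_pointConv_ne_top (hg1 n) _ _, fun x y => le_iInf fun n =>
      lintegral_mono (indicator_one_le_of_eq_one (hgE n)), fun y => ?_⟩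
  have hle : ∀ n : ℕ, ∫⁻ x, ⨅ n, ∫⁻ w, (g n w : ℝ≥0∞) ∂(H.pointConv x (H.inv y)) ∂lam ≤
      lam E + ((n : ℝ≥0∞) + 1)⁻¹ := by
    intro n
    calc ∫⁻ x, ⨅ n, ∫⁻ w, (g n w : ℝ≥0∞) ∂(H.pointConv x (H.inv y)) ∂lam
        ≤ ∫⁻ x, H.translate (H.inv y) (fun w => g n w) x ∂lam := by
          refine lintegral_mono fun x => (iInf_le _ n).trans_eq ?_
          rw [hcomm x]
          rfl
      _ = ∫⁻ x, g n x ∂lam := hlam.lintegral_translate _ _ (hgc n).measurable.coe_nnreal_ennreal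
      _ ≤ lam (U n) := by
          rw [← lintegral_indicator_one (hU n).measurableSet]
          exact lintegral_mono (le_indicator_one_of_eq_zero (hg1 n) (hgU n))
      _ ≤ _ := (hlU n).le
  have ht : Tendsto (fun m : ℕ => lam E + ((m : ℝ≥0∞) + 1)⁻¹) atTop (𝓝 (lam E + 0)) := by
    refine tendsto_const_nhds.add ?_
    simpa using (tendsto_add_atTop_iff_nat 1).2 ENNReal.tendsto_inv_nat_nhds_zero
  rw [add_zero] at ht
  exact ge_of_tendsto' ht hle

/-- For a null compact `E` the majorant has zero double integral, hence a zero section at some `x`.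
By `lintegral_translate_inv` that section's integral dominates `λ(E~)`, whatever `x` is. -/
theorem IsHaar.map_inv_absolutelyContinuous [SigmaFinite lam] (hcomm : H.IsCommutative)
    (hlam : H.IsHaar lam) : lam.map H.inv ≪ lam := by
  have := hlam.regular
  have : (lam.map H.inv).Regular := Measure.Regular.map H.inv
  have : SigmaFinite (lam.map H.inv) := H.inv.toMeasurableEquiv.sigmaFinite_map
  refine Measure.AbsolutelyContinuous.mk fun Z hZ hZ0 => ?_
  rw [hZ.measure_eq_iSup_isCompact]
  refine le_antisymm (iSup₂_le fun E hEZ => iSup_le fun hE => ?_) zero_le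
  have hE0 : lam E = 0 := measure_mono_null hEZ hZ0
  obtain ⟨F, hF, hEF, hFE⟩ := hlam.exists_aemeasurable_majorant hcomm hE
  have h0 : ∫⁻ x, ∫⁻ y, F (x, y) ∂lam ∂lam = 0 := by
    rw [lintegral_lintegral_swap (f := fun x y => F (x, y)) hF]
    refine le_antisymm ((lintegral_mono hFE).trans ?_) zero_le
    simp [hE0]
  rw [lintegral_eq_zero_iff' hF.lintegral_prod_right'] at h0
  have : NeZero lam := ⟨hlam.ne_zero⟩
  obtain ⟨x, hx⟩ := h0.exists
  rw [← hlam.lintegral_translate_inv hcomm hE.measurableSet x]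
  exact (lintegral_mono (hEF x)).trans hx.le

/-- A Haar measure dominates its image under the involution. -/
theorem IsHaar.exists_map_inv_le (hcomm : H.IsCommutative) (hlam : H.IsHaar lam)
    {ρ : K → K → ℝ} (hρ : IsQuasiMetric ρ) (hd : IsDoublingMeasure ρ lam)
    (hsupp : H.SupportCondition ρ) : ∃ C : ℝ≥0, lam.map H.inv ≤ C • lam := by
  have := hlam.regular
  have : Nonempty K := ⟨H.e⟩
  have : SigmaFinite lam := hd.sigmaFinite
  have : (lam.map H.inv).Regular := Measure.Regular.map H.inv
  have : SigmaFinite (lam.map H.inv) := H.inv.toMeasurableEquiv.sigmaFinite_map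
  obtain ⟨c₁, hc₁, hs⟩ := hsupp
  obtain ⟨c, hc, htri⟩ := hρ.quasi_triangle
  -- If `x ∈ B(e, s)` and `y ∈ B(x, s)`, the quasi-triangle inequality puts `y` in `B(e, 2cs)`; here
  -- `s = c₁ R`.
  obtain ⟨C, hC⟩ := hd.exists_measure_mul_le (2 * c)
  have key : ∀ (R : ℝ) (E : Set K), 0 < R → IsCompact E → E ⊆ quasiBall ρ H.e R →
      lam.map H.inv E ≤ C * lam E := by
    intro R E hR hE hER
    obtain ⟨F, hF, hEF, hFE⟩ := hlam.exists_aemeasurable_majorant hcomm hE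
    have hS : 0 < c₁ * R := by positivity
    set A := quasiBall ρ H.e (c₁ * R) with hA
    set B := quasiBall ρ H.e (2 * c * (c₁ * R)) with hB
    have hx : ∀ x ∈ A, lam.map H.inv E ≤ ∫⁻ y in B, F (x, y) ∂lam := by
      intro x hxA
      rw [← hlam.lintegral_translate_inv hcomm hE.measurableSet x,
        ← lintegral_indicator₀ (hd.nullMeasurableSet_ball _ _)]
      refine lintegral_mono fun y => ?_
      by_cases hy : y ∈ B
      · rw [indicator_of_mem hy]
        exact hEF x y
      · have hy0 : H.ballTranslate ρ R x y = 0 := by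
          by_contra hne
          have h1 := hs x R hR (subset_tsupport _ hne)
          refine hy ((htri H.e y x).trans_lt ?_)
          have h2 : ρ H.e x < c₁ * R := hxA
          have h3 : ρ x y < c₁ * R := h1
          nlinarith
        have h1 : H.translate x (E.indicator 1) (H.inv y) ≤ H.ballTranslate ρ R x y :=
          lintegral_mono fun z => indicator_le_indicator_of_subset hER (fun _ => zero_le) z
        rw [hy0] at h1
        exact h1.trans zero_le
    -- Integrating `F` over `A × B` in both orders gives `λ(A) λ(E~) ≤ λ(B) λ(E)`, and doubling
    -- replaces `B` by `A`.
    have h1 : lam A * lam.map H.inv E ≤ lam A * (C * lam E) := by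
      calc lam A * lam.map H.inv E = ∫⁻ _ in A, lam.map H.inv E ∂lam := by
            rw [setLIntegral_const, mul_comm]
        _ ≤ ∫⁻ x in A, ∫⁻ y in B, F (x, y) ∂lam ∂lam :=
            lintegral_mono_ae ((ae_restrict_iff'₀ (hd.nullMeasurableSet_ball _ _)).2
              (Eventually.of_forall hx))
        _ = ∫⁻ y in B, ∫⁻ x in A, F (x, y) ∂lam ∂lam :=
            lintegral_lintegral_swap (f := fun x y => F (x, y)) (hF.mono_ac
              (Measure.restrict_le_self.absolutelyContinuous.prod
              Measure.restrict_le_self.absolutelyContinuous))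
        _ ≤ ∫⁻ y in B, lam E ∂lam := lintegral_mono fun y =>
            (lintegral_mono' Measure.restrict_le_self le_rfl).trans (hFE y)
        _ = lam E * lam B := setLIntegral_const _ _
        _ ≤ lam E * (C * lam A) := mul_le_mul_right (hC H.e (c₁ * R) hS) _
        _ = lam A * (C * lam E) := by ring
    exact (ENNReal.mul_le_mul_iff_right (hd.measure_pos _ hS).ne' (hd.measure_lt_top _ _).ne).1 h1
  refine ⟨C, Measure.le_iff.2 fun A hA => ?_⟩
  have hAU : A = ⋃ n : ℕ, A ∩ quasiBall ρ H.e n := by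
    rw [← inter_iUnion, eq_comm, inter_eq_left]
    exact fun y _ => mem_iUnion.2 (exists_nat_gt (ρ H.e y))
  have hmono : Monotone fun n : ℕ => A ∩ quasiBall ρ H.e n := fun m n hmn =>
    inter_subset_inter_right _ (quasiBall_mono (Nat.cast_le.2 hmn))
  conv_lhs => rw [hAU, hmono.measure_iUnion]
  refine iSup_le fun n => ?_
  -- Absolute continuity makes the ball null measurable for the image measure too, so a Borel subset
  -- of full image measure can be exhausted by compact sets.
  obtain ⟨t, ht, htm, hteq⟩ := (hA.nullMeasurableSet.inter ((hd.nullMeasurableSet_ball H.e n).mono_ac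
    (hlam.map_inv_absolutelyContinuous hcomm))).exists_measurable_subset_ae_eq
  rw [← measure_congr hteq, htm.measure_eq_iSup_isCompact]
  refine iSup₂_le fun E hEt => iSup_le fun hE => ?_
  have hEn : E ⊆ quasiBall ρ H.e (n + 1) :=
    (hEt.trans (ht.trans inter_subset_right)).trans (quasiBall_mono (by linarith))
  refine (key (n + 1) E (by positivity) hE hEn).trans ?_
  exact mul_le_mul_right (measure_mono (hEt.trans (ht.trans inter_subset_left))) _

end Hypergroup

/-! ### Vitali covering and real interpolation. -/

section WeakType

variable {K : Type*} [MeasurableSpace K] {ρ : K → K → ℝ} {lam : Measure K}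

/-- The weak type `(1, 1)` inequality for averages over balls of bounded radius. -/
theorem IsDoublingMeasure.exists_weak_type (hρ : IsQuasiMetric ρ) (hd : IsDoublingMeasure ρ lam)
    [SFinite lam] :
    ∃ C : ℝ≥0, ∀ (F : K → ℝ≥0∞) (t : ℝ≥0∞) (S : Set K) (R : ℝ),
      (∀ x ∈ S, ∃ r, 0 < r ∧ r ≤ R ∧
        t * lam (quasiBall ρ x r) ≤ ∫⁻ y in quasiBall ρ x r, F y ∂lam) →
      t * lam S ≤ C * ∫⁻ y, F y ∂lam := by
  obtain ⟨c, hc, htri⟩ := hρ.quasi_triangle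
  -- Vitali selection gives a meeting ball with `r a ≤ 2 r b`, so `ρ b a ≤ c (r b + r a)` is below
  -- the radius `3 c r b`.
  obtain ⟨C, hC⟩ := hd.exists_measure_mul_le (3 * c)
  -- The added `1` makes the constant nonzero, so the bound is `∞` when the integral is.
  refine ⟨C + 1, fun F t S R hS => ?_⟩
  rcases eq_or_ne t 0 with rfl | ht
  · simp
  rcases eq_or_ne (∫⁻ y, F y ∂lam) ∞ with hF | hF
  · rw [hF, ENNReal.mul_top (by simp)]
    exact le_top
  choose! r hr hrR hrF using hS
  obtain ⟨u, huS, hu, hcov⟩ := Vitali.exists_disjoint_subfamily_covering_enlargement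
    (fun x => quasiBall ρ x (r x)) S r 2 one_lt_two (fun x hx => (hr x hx).le) R hrR
    (fun x hx => ⟨x, hρ.mem_quasiBall_self x (hr x hx)⟩)
  have hsum : ∑' b : u, t * lam (quasiBall ρ b (r b)) ≤ ∫⁻ y, F y ∂lam := by
    calc ∑' b : u, t * lam (quasiBall ρ b (r b))
        ≤ ∑' b : u, (lam.withDensity F) (quasiBall ρ b (r b)) := by
          refine ENNReal.tsum_le_tsum fun b => ?_
          rw [withDensity_apply']
          exact hrF b (huS b.2)
      _ ≤ (lam.withDensity F) (⋃ b : u, quasiBall ρ b (r b)) := by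
          refine tsum_meas_le_meas_iUnion_of_disjoint₀ _ (fun b =>
            (hd.nullMeasurableSet_ball _ _).mono_ac (withDensity_absolutelyContinuous _ _)) ?_
          intro a b hab
          exact (hu a.2 b.2 (fun h => hab (Subtype.ext h))).aedisjoint
      _ ≤ (lam.withDensity F) univ := measure_mono (subset_univ _)
      _ = ∫⁻ y, F y ∂lam := by rw [withDensity_apply', Measure.restrict_univ]
  -- A convergent sum has countable support, and all the selected balls have positive measure.
  have hcount : u.Countable := by
    have h1 := Summable.countable_support_ennreal (ne_top_of_le_ne_top hF hsum)
    have h2 : support (fun b : u => t * lam (quasiBall ρ b (r b))) = univ :=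
      eq_univ_of_forall fun b => mul_ne_zero ht (hd.measure_pos _ (hr b (huS b.2))).ne'
    rw [h2, countable_univ_iff] at h1
    exact countable_coe_iff.1 h1
  have hSu : S ⊆ ⋃ b ∈ u, quasiBall ρ b (3 * c * r b) := by
    intro a ha
    obtain ⟨b, hbu, ⟨z, hza, hzb⟩, hab⟩ := hcov a ha
    refine mem_iUnion₂.2 ⟨b, hbu, ?_⟩
    have h1 : ρ a z < r a := hza
    have h2 : ρ b z < r b := hzb
    have h3 := htri b a z
    rw [hρ.symm z a] at h3
    change ρ b a < _
    nlinarith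
  calc t * lam S ≤ t * ∑' b : u, lam (quasiBall ρ b (3 * c * r b)) :=
        mul_le_mul_right ((measure_mono hSu).trans (measure_biUnion_le _ hcount _)) _
    _ ≤ t * ∑' b : u, C * lam (quasiBall ρ b (r b)) :=
        mul_le_mul_right (ENNReal.tsum_le_tsum fun b : u => hC b _ (hr b (huS b.2))) _
    _ = C * ∑' b : u, t * lam (quasiBall ρ b (r b)) := by
        rw [ENNReal.tsum_mul_left, ENNReal.tsum_mul_left]
        ring
    _ ≤ (C + 1 : ℝ≥0) * ∫⁻ y, F y ∂lam := mul_le_mul' (by simp) hsum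

/-- A function satisfying a truncated weak type inequality satisfies a strong type inequality. -/
theorem lintegral_rpow_le_of_weak_type {G : K → ℝ≥0∞} (hG : AEMeasurable G lam) {f : K → ℝ≥0}
    (hf : Measurable f) {C : ℝ≥0} {p : ℝ} (hp : 1 < p)
    (h : ∀ t : ℝ, 0 < t → ENNReal.ofReal t * lam {x | ENNReal.ofReal t < G x} ≤
      C * ∫⁻ x in {x | t < 2 * f x}, f x ∂lam) :
    ∫⁻ x, G x ^ p ∂lam ≤
      (C * ENNReal.ofReal p * (ENNReal.ofReal (p - 1))⁻¹ * 2 ^ (p - 1)) *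
        ∫⁻ x, (f x : ℝ≥0∞) ^ p ∂lam := by
  have hp0 : 0 < p := one_pos.trans hp
  have hp1 : 0 < p - 1 := sub_pos.2 hp
  set ν := lam.withDensity fun x => (f x : ℝ≥0∞) with hν
  have hfe : Measurable fun x => (f x : ℝ≥0∞) := hf.coe_nnreal_ennreal
  have hlev : ∀ t : ℝ, MeasurableSet {x | t < 2 * (f x : ℝ)} := fun t =>
    measurableSet_lt measurable_const (hf.coe_nnreal_real.const_mul 2)
  -- Layer cake for `ν = f dλ` with exponent `p - 1`: after multiplication by `t ^ (p - 2)`, the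
  -- right side of the weak inequality integrates to this.
  have hcake : ∫⁻ x, ENNReal.ofReal ((2 * (f x : ℝ)) ^ (p - 1)) ∂ν = ENNReal.ofReal (p - 1) *
      ∫⁻ t in Ioi (0 : ℝ), ν {x | t < 2 * (f x : ℝ)} * ENNReal.ofReal (t ^ (p - 1 - 1)) :=
    lintegral_rpow_eq_lintegral_meas_lt_mul ν (Eventually.of_forall fun x => by positivity)
      (hf.coe_nnreal_real.const_mul 2).aemeasurable hp1
  have hpow : ∫⁻ x, ENNReal.ofReal ((2 * (f x : ℝ)) ^ (p - 1)) ∂ν =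
      2 ^ (p - 1) * ∫⁻ x, (f x : ℝ≥0∞) ^ p ∂lam := by
    rw [hν, lintegral_withDensity_eq_lintegral_mul _ hfe
      ((hf.coe_nnreal_real.const_mul 2).pow_const _).ennreal_ofReal,
      ← lintegral_const_mul _ (hfe.pow_const p)]
    refine lintegral_congr fun x => ?_
    rw [Pi.mul_apply, ← ENNReal.ofReal_rpow_of_nonneg (by positivity) hp1.le,
      ENNReal.ofReal_mul zero_le_two, ENNReal.ofReal_coe_nnreal, ENNReal.ofReal_ofNat,
      ENNReal.mul_rpow_of_nonneg _ _ hp1.le, mul_left_comm]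
    congr 1
    rcases eq_or_ne (f x) 0 with h0 | h0
    · simp [h0, hp0]
    · conv_rhs => rw [← add_sub_cancel 1 p, ENNReal.rpow_add _ _ (by simpa using h0)
        ENNReal.coe_ne_top, ENNReal.rpow_one]
  -- Capping `G` at `n` keeps it finite, so passing to real values loses nothing; monotone
  -- convergence removes the cap.
  have hn : ∀ n : ℕ, ∫⁻ x, (min (G x) n) ^ p ∂lam ≤
      (C * ENNReal.ofReal p * (ENNReal.ofReal (p - 1))⁻¹ * 2 ^ (p - 1)) *
        ∫⁻ x, (f x : ℝ≥0∞) ^ p ∂lam := by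
    intro n
    have hfin : ∀ x, min (G x) (n : ℝ≥0∞) ≠ ∞ := fun x =>
      ne_top_of_le_ne_top (ENNReal.natCast_ne_top n) (min_le_right _ _)
    have h1 := lintegral_rpow_eq_lintegral_meas_lt_mul lam (f := fun x => (min (G x) n).toReal)
      (Eventually.of_forall fun x => ENNReal.toReal_nonneg)
      (hG.min aemeasurable_const).ennreal_toReal hp0
    calc ∫⁻ x, (min (G x) n) ^ p ∂lam
        = ∫⁻ x, ENNReal.ofReal ((min (G x) n).toReal ^ p) ∂lam := by
          refine lintegral_congr fun x => ?_
          rw [← ENNReal.ofReal_rpow_of_nonneg ENNReal.toReal_nonneg hp0.le,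
            ENNReal.ofReal_toReal (hfin x)]
      _ = _ := h1
      _ ≤ ENNReal.ofReal p * ∫⁻ t in Ioi (0 : ℝ),
            C * (ν {x | t < 2 * (f x : ℝ)} * ENNReal.ofReal (t ^ (p - 1 - 1))) := by
          refine mul_le_mul_right (setLIntegral_mono' measurableSet_Ioi fun t ht => ?_) _
          have ht0 : 0 < t := ht
          have hsub : {x | t < (min (G x) n).toReal} ⊆ {x | ENNReal.ofReal t < G x} := by
            intro x hx
            exact ((ENNReal.ofReal_lt_iff_lt_toReal ht0.le (hfin x)).2 hx).trans_le (min_le_left _ _)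
          have h2 := h t ht0
          have h3 : t ^ (p - 1) = t * t ^ (p - 1 - 1) := by
            rw [Real.rpow_sub_one ht0.ne' (p - 1)]
            field_simp
          rw [h3, ENNReal.ofReal_mul ht0.le, ← mul_assoc, ← mul_assoc, mul_comm (lam _)]
          refine mul_le_mul_left ((mul_le_mul_right (measure_mono hsub) _).trans (h2.trans_eq ?_)) _
          rw [hν, withDensity_apply _ (hlev t)]
      _ = ENNReal.ofReal p * (C * ((ENNReal.ofReal (p - 1))⁻¹ *
            (2 ^ (p - 1) * ∫⁻ x, (f x : ℝ≥0∞) ^ p ∂lam))) := by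
          rw [lintegral_const_mul' _ _ ENNReal.coe_ne_top, ← hpow, hcake, ← mul_assoc (_⁻¹),
            ENNReal.inv_mul_cancel (by simpa using hp) ENNReal.ofReal_ne_top, one_mul]
      _ = _ := by ring
  have hsup : ∀ x, G x ^ p = ⨆ n : ℕ, (min (G x) n) ^ p := by
    intro x
    have h1 := (ENNReal.orderIsoRpow p hp0).map_iSup fun n : ℕ => min (G x) n
    rw [← inf_iSup_eq, ENNReal.iSup_natCast, inf_top_eq] at h1
    exact h1
  simp only [hsup]
  rw [lintegral_iSup' (fun n => (hG.min aemeasurable_const).pow_const p)]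
  · exact iSup_le hn
  · refine Eventually.of_forall fun x m n hmn => ENNReal.rpow_le_rpow ?_ hp0.le
    exact min_le_min_left _ (Nat.cast_le.2 hmn)

end WeakType

/-! ### Sums of minima of two geometric sequences. -/

/-- The first entry is summable over negative `i`, the second over `i ≥ 0`. The factor `2 ^ b`
allows for rounding the crossing scale to a power of two. -/
theorem tsum_int_two_rpow_min_ne_top {a b : ℝ} (ha : 0 < a) (hb : 0 < b) :
    ∑' i : ℤ, min ((2 : ℝ≥0∞) ^ (i * a)) (2 ^ b * 2 ^ (-(i * b))) ≠ ∞ := by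
  have hgeo : ∀ s : ℝ, 0 < s → ∑' n : ℕ, (2 : ℝ≥0∞) ^ (-(n * s)) ≠ ∞ := by
    intro s hs
    have h1 : ∀ n : ℕ, (2 : ℝ≥0∞) ^ (-(n * s)) = (2 ^ (-s)) ^ n := fun n => by
      rw [← ENNReal.rpow_natCast, ← ENNReal.rpow_mul]
      ring_nf
    simp only [h1]
    rw [ENNReal.tsum_geometric, ENNReal.inv_ne_top, ne_eq, tsub_eq_zero_iff_le, not_le]
    exact ENNReal.rpow_lt_one_of_one_lt_of_neg ENNReal.one_lt_two (neg_lt_zero.2 hs)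
  set f : ℤ → ℝ≥0∞ := fun i => min ((2 : ℝ≥0∞) ^ (i * a)) (2 ^ b * 2 ^ (-(i * b))) with hf
  have hs : HasSum f (∑' n : ℕ, f n + ∑' n : ℕ, f (-(n + 1))) :=
    HasSum.of_nat_of_neg_add_one ENNReal.summable.hasSum ENNReal.summable.hasSum
  rw [hs.tsum_eq]
  refine ENNReal.add_ne_top.2 ⟨?_, ?_⟩
  · have h2 : ∑' n : ℕ, (2 : ℝ≥0∞) ^ b * 2 ^ (-(n * b)) ≠ ∞ := by
      rw [ENNReal.tsum_mul_left]
      exact ENNReal.mul_ne_top (by simp) (hgeo b hb)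
    refine ne_top_of_le_ne_top h2 (ENNReal.tsum_le_tsum fun n => ?_)
    simp [hf]
  · refine ne_top_of_le_ne_top (hgeo a ha) (ENNReal.tsum_le_tsum fun n => ?_)
    refine (min_le_left _ _).trans (ENNReal.rpow_le_rpow_of_exponent_le ENNReal.one_lt_two.le ?_)
    push_cast
    nlinarith

/-- Interpolation between two dyadic bounds. -/
theorem exists_tsum_int_min_le {a b : ℝ} (ha : 0 < a) (hb : 0 < b) :
    ∃ C : ℝ≥0, ∀ m Φ : ℝ≥0∞,
      ∑' j : ℤ, min ((2 : ℝ≥0∞) ^ (j * a) * m) (2 ^ (-(j * b)) * Φ) ≤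
        C * (m ^ (b / (a + b)) * Φ ^ (a / (a + b))) := by
  have hab : 0 < a + b := add_pos ha hb
  set S := ∑' i : ℤ, min ((2 : ℝ≥0∞) ^ (i * a)) (2 ^ b * 2 ^ (-(i * b))) with hS
  have hSfin : S ≠ ∞ := tsum_int_two_rpow_min_ne_top ha hb
  refine ⟨S.toNNReal + 1, fun m Φ => ?_⟩
  have hle : S ≤ (S.toNNReal + 1 : ℝ≥0) := by
    rw [ENNReal.coe_add, ENNReal.coe_toNNReal hSfin]
    exact le_self_add
  have hC0 : ((S.toNNReal + 1 : ℝ≥0) : ℝ≥0∞) ≠ 0 := by simp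
  rcases eq_or_ne m 0 with rfl | hm0
  · simp
  rcases eq_or_ne Φ 0 with rfl | hΦ0
  · simp
  have hda : 0 < a / (a + b) := by positivity
  have hdb : 0 < b / (a + b) := by positivity
  rcases eq_or_ne m ∞ with rfl | hm
  · rw [ENNReal.top_rpow_of_pos hdb, ENNReal.top_mul (by simp [hΦ0, hda.not_gt]),
      ENNReal.mul_top hC0]
    exact le_top
  rcases eq_or_ne Φ ∞ with rfl | hΦ
  · rw [ENNReal.top_rpow_of_pos hda, ENNReal.mul_top (by simp [hm0, hdb.not_gt]),
      ENNReal.mul_top hC0]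
    exact le_top
  -- `s` is the scale at which the bounds agree: `s ^ a * m = s ^ (-b) * Φ = X`. With `2 ^ J ≤ s < 2
  -- ^ (J + 1)`, shifting the index by `J` leaves a sum independent of `m` and `Φ`.
  set s := (Φ / m) ^ (1 / (a + b)) with hs
  have hr0 : Φ / m ≠ 0 := (ENNReal.div_pos hΦ0 hm).ne'
  have hrt : Φ / m ≠ ∞ := ENNReal.div_ne_top hΦ hm0
  have hs0 : s ≠ 0 := (ENNReal.rpow_pos (pos_iff_ne_zero.2 hr0) hrt).ne'
  have hst : s ≠ ∞ := ENNReal.rpow_ne_top_of_nonneg (by positivity) hrt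
  obtain ⟨J, hJ1, hJ2⟩ := ENNReal.exists_mem_Ico_zpow hs0 hst ENNReal.one_lt_two
    ENNReal.ofNat_ne_top
  set X := m ^ (b / (a + b)) * Φ ^ (a / (a + b)) with hX
  have hsa : s ^ a * m = X := by
    rw [hs, ← ENNReal.rpow_mul, ENNReal.div_rpow_of_nonneg _ _ (by positivity), hX,
      show 1 / (a + b) * a = a / (a + b) by ring,
      show b / (a + b) = 1 - a / (a + b) by field_simp; ring,
      ENNReal.rpow_sub _ _ hm0 hm, ENNReal.rpow_one, ENNReal.div_eq_inv_mul,
      ENNReal.div_eq_inv_mul]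
    ring
  have hsb : s ^ (-b) * Φ = X := by
    rw [hs, ← ENNReal.rpow_mul, show 1 / (a + b) * -b = -(b / (a + b)) by ring,
      ENNReal.rpow_neg, ENNReal.div_rpow_of_nonneg _ _ (by positivity), hX,
      ENNReal.inv_div (Or.inr (ENNReal.rpow_ne_top_of_nonneg hdb.le hΦ))
        (Or.inr (ENNReal.rpow_pos (pos_iff_ne_zero.2 hΦ0) hΦ).ne'),
      show a / (a + b) = 1 - b / (a + b) by field_simp; ring,
      ENNReal.rpow_sub _ _ hΦ0 hΦ, ENNReal.rpow_one, ENNReal.div_eq_inv_mul,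
      ENNReal.div_eq_inv_mul]
    ring
  have h2 : (2 : ℝ≥0∞) ≠ 0 := two_ne_zero
  have h2t : (2 : ℝ≥0∞) ≠ ∞ := ENNReal.ofNat_ne_top
  rw [← (Equiv.addLeft J).tsum_eq]
  calc ∑' i : ℤ, min ((2 : ℝ≥0∞) ^ (((Equiv.addLeft J i : ℤ) : ℝ) * a) * m)
        (2 ^ (-(((Equiv.addLeft J i : ℤ) : ℝ) * b)) * Φ)
      ≤ ∑' i : ℤ, min ((2 : ℝ≥0∞) ^ (i * a)) (2 ^ b * 2 ^ (-(i * b))) * X := by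
        refine ENNReal.tsum_le_tsum fun i => ?_
        rw [(show Monotone fun x : ℝ≥0∞ => x * X from fun _ _ h => mul_le_mul_left h X).map_min]
        refine min_le_min ?_ ?_
        · rw [← hsa, Equiv.coe_addLeft, Int.cast_add, add_mul, ENNReal.rpow_add _ _ h2 h2t,
            mul_comm (2 ^ ((J : ℝ) * a)), mul_assoc]
          refine mul_le_mul_right (mul_le_mul_left ?_ _) _
          rw [ENNReal.rpow_mul, ENNReal.rpow_intCast]
          exact ENNReal.rpow_le_rpow hJ1 ha.le
        · rw [← hsb, Equiv.coe_addLeft, Int.cast_add,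
            show -(((J : ℝ) + i) * b) = (b + -(i * b)) + (J + 1 : ℝ) * (-b) by ring,
            ENNReal.rpow_add _ _ h2 h2t, ENNReal.rpow_add _ _ h2 h2t, mul_assoc]
          refine mul_le_mul_right (mul_le_mul_left ?_ _) _
          rw [ENNReal.rpow_mul, ENNReal.rpow_neg, ENNReal.rpow_neg, ENNReal.inv_le_inv]
          refine ENNReal.rpow_le_rpow (hJ2.le.trans_eq ?_) hb.le
          rw [← ENNReal.rpow_intCast]
          push_cast
          rfl
    _ = S * X := ENNReal.tsum_mul_right
    _ ≤ _ := mul_le_mul_left hle _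

/-! ### Convolution operators and the dyadic maximal function. -/

theorem aemeasurable_indicator_quasiBall {K : Type*} [MeasurableSpace K] {ρ : K → K → ℝ}
    {lam : Measure K} (hd : IsDoublingMeasure ρ lam) (x : K) (r : ℝ) :
    AEMeasurable ((quasiBall ρ x r).indicator (1 : K → ℝ≥0∞)) lam :=
  aemeasurable_one.indicator₀ (hd.nullMeasurableSet_ball x r)

theorem lintegral_indicator_quasiBall {K : Type*} [MeasurableSpace K] {ρ : K → K → ℝ}
    {lam : Measure K} (hd : IsDoublingMeasure ρ lam) (x : K) (r : ℝ) :
    ∫⁻ y, (quasiBall ρ x r).indicator 1 y ∂lam = lam (quasiBall ρ x r) :=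
  lintegral_indicator_one₀ (hd.nullMeasurableSet_ball x r)

namespace Hypergroup

variable {K : Type*} [TopologicalSpace K] [T2Space K] [LocallyCompactSpace K]
  [MeasurableSpace K] [BorelSpace K]

/-- The convolution `x ↦ ∫ T^x w (y) F(y~) dλ(y)` of nonnegative functions. -/
noncomputable def lconv (H : Hypergroup K) (lam : Measure K) (w F : K → ℝ≥0∞) (x : K) : ℝ≥0∞ :=
  ∫⁻ y, H.translate x w y * F (H.inv y) ∂lam

variable {H : Hypergroup K} {lam : Measure K} {w F : K → ℝ≥0∞}

theorem IsHaar.exists_aemeasurable_prod_translate_ae [SigmaFinite lam] (hlam : H.IsHaar lam)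
    (hw : AEMeasurable w lam) :
    ∃ h : K × K → ℝ≥0∞, AEMeasurable h (lam.prod lam) ∧
      ∀ x, H.translate x w =ᵐ[lam] fun y => h (x, y) := by
  obtain ⟨h, hm, hh⟩ := hlam.exists_aemeasurable_prod_translate hw.measurable_mk
  exact ⟨h, hm, fun x => (hlam.translate_congr_ae hw.ae_eq_mk x).trans (hh x)⟩

theorem IsHaar.aemeasurable_lconv [SigmaFinite lam] (hlam : H.IsHaar lam)
    (hw : AEMeasurable w lam) (hF : Measurable F) : AEMeasurable (H.lconv lam w F) lam := by
  obtain ⟨h, hm, hh⟩ := hlam.exists_aemeasurable_prod_translate_ae hw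
  have h1 : AEMeasurable (fun x => ∫⁻ y, h (x, y) * F (H.inv y) ∂lam) lam :=
    (hm.mul ((hF.comp H.inv.continuous.measurable).comp
      measurable_snd).aemeasurable).lintegral_prod_right'
  refine h1.congr (Eventually.of_forall fun x => lintegral_congr_ae ?_)
  filter_upwards [hh x] with y hy
  rw [hy]

theorem IsHaar.lconv_le_tsum (hlam : H.IsHaar lam) {c : ℤ → ℝ≥0∞} {v : ℤ → K → ℝ≥0∞}
    (hv : ∀ j, AEMeasurable (v j) lam) (hF : Measurable F)
    (hw : ∀ᵐ z ∂lam, w z ≤ ∑' j, c j * v j z) (x : K) :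
    H.lconv lam w F x ≤ ∑' j, c j * H.lconv lam (v j) F x := by
  have hFi : Measurable fun y => F (H.inv y) := hF.comp H.inv.continuous.measurable
  have hT : ∀ j, AEMeasurable (fun y => H.translate x (v j) y * F (H.inv y)) lam := fun j =>
    (hlam.aemeasurable_translate (hv j) x).mul hFi.aemeasurable
  calc H.lconv lam w F x
      ≤ ∫⁻ y, ∑' j, c j * (H.translate x (v j) y * F (H.inv y)) ∂lam := by
        refine lintegral_mono_ae ?_
        filter_upwards [hlam.ae_ae_pointConv hw x, ae_all_iff.2 fun j =>
          hlam.ae_ae_pointConv (hv j).ae_eq_mk x] with y hy hvy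
        have hvm : ∀ j, AEMeasurable (v j) (H.pointConv x y) := fun j =>
          ⟨_, (hv j).measurable_mk, hvy j⟩
        have h1 : H.translate x w y ≤ ∑' j, c j * H.translate x (v j) y := by
          refine (lintegral_mono_ae hy).trans_eq ?_
          rw [lintegral_tsum fun j => (hvm j).const_mul _]
          exact tsum_congr fun j => lintegral_const_mul'' _ (hvm j)
        refine (mul_le_mul_left h1 _).trans_eq ?_
        rw [← ENNReal.tsum_mul_right]
        exact tsum_congr fun j => mul_assoc _ _ _
    _ = ∑' j, c j * H.lconv lam (v j) F x := by
        rw [lintegral_tsum fun j => (hT j).const_mul _]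
        exact tsum_congr fun j => lintegral_const_mul'' _ (hT j)

theorem IsHaar.lconv_le_const_mul (hlam : H.IsHaar lam) (hw : AEMeasurable w lam) {s : ℝ≥0∞}
    (hF : ∀ y, F y ≤ s) (x : K) : H.lconv lam w F x ≤ (∫⁻ y, w y ∂lam) * s := by
  rw [← hlam.lintegral_translate_ae hw x,
    ← lintegral_mul_const'' _ (hlam.aemeasurable_translate hw x)]
  exact lintegral_mono fun y => mul_le_mul_right (hF _) _

theorem IsHaar.lconv_add (hlam : H.IsHaar lam) (hw : AEMeasurable w lam) (hF : Measurable F)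
    (G : K → ℝ≥0∞) (x : K) :
    H.lconv lam w (F + G) x = H.lconv lam w F x + H.lconv lam w G x := by
  have hFi : Measurable fun y => F (H.inv y) := hF.comp H.inv.continuous.measurable
  have hm : AEMeasurable (fun y => H.translate x w y * F (H.inv y)) lam :=
    (hlam.aemeasurable_translate hw x).mul hFi.aemeasurable
  rw [lconv, lconv, lconv, ← lintegral_add_left' hm]
  exact lintegral_congr fun y => mul_add _ _ _

theorem lconv_mono {G : K → ℝ≥0∞} (h : ∀ y, F y ≤ G y) (x : K) :
    H.lconv lam w F x ≤ H.lconv lam w G x :=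
  lintegral_mono fun _ => mul_le_mul_right (h _) _

/-- The involution is a measurable equivalence, so `G` may be arbitrary; no measurability of
`ballTranslate` is needed later. -/
theorem lintegral_comp_inv_le {C : ℝ≥0} (hC : lam.map H.inv ≤ C • lam) (G : K → ℝ≥0∞) :
    ∫⁻ y, G (H.inv y) ∂lam ≤ C * ∫⁻ y, G y ∂lam := by
  calc ∫⁻ y, G (H.inv y) ∂lam = ∫⁻ y, G y ∂(lam.map H.inv) :=
        (lintegral_map_equiv G H.inv.toMeasurableEquiv).symm
    _ ≤ ∫⁻ y, G y ∂(C • lam) := lintegral_mono' hC le_rfl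
    _ = C * ∫⁻ y, G y ∂lam := by
        rw [lintegral_smul_measure]
        rfl

/-- As `T^x w ≤ 1`, its power with the conjugate exponent is at most `T^x w`, whose integral is that
of `w` by invariance. -/
theorem IsHaar.lconv_le_holder (hlam : H.IsHaar lam) {C : ℝ≥0} (hC : lam.map H.inv ≤ C • lam)
    (hw : AEMeasurable w lam) (hw1 : ∀ y, w y ≤ 1) (hF : Measurable F) {p : ℝ} (hp : 1 < p)
    (x : K) :
    H.lconv lam w F x ≤
      (∫⁻ y, w y ∂lam) ^ (1 - 1 / p) * (C * ∫⁻ y, F y ^ p ∂lam) ^ (1 / p) := by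
  have hpq := Real.HolderConjugate.conjExponent hp
  have hp0 : 0 < p := one_pos.trans hp
  have hT1 : ∀ y, H.translate x w y ≤ 1 := fun y =>
    (lintegral_mono hw1).trans (by simp)
  refine (ENNReal.lintegral_mul_le_Lp_mul_Lq lam hpq.symm (hlam.aemeasurable_translate hw x)
    (hF.comp H.inv.continuous.measurable).aemeasurable).trans ?_
  refine mul_le_mul' ?_ (ENNReal.rpow_le_rpow ?_ (by positivity))
  · have h1 : 1 / p.conjExponent = 1 - 1 / p := by
      have := hpq.inv_add_inv_eq_one
      rw [one_div, one_div]
      linarith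
    rw [h1]
    refine ENNReal.rpow_le_rpow ?_ (sub_nonneg.2 ((div_le_one hp0).2 hp.le))
    rw [← hlam.lintegral_translate_ae hw x]
    refine lintegral_mono fun y => ?_
    exact (ENNReal.rpow_le_rpow_of_exponent_ge (hT1 y) hpq.symm.lt.le).trans_eq
      (ENNReal.rpow_one _)
  · exact lintegral_comp_inv_le hC fun y => F y ^ p

variable {ρ : K → K → ℝ}

/-- Convolution with the indicator of a ball is dominated by an average over a ball. -/
theorem lconv_indicator_mul_le (hd : IsDoublingMeasure ρ lam) {C c₂ : ℝ≥0} {c₁ r : ℝ} {x : K}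
    (hC : lam.map H.inv ≤ C • lam)
    (hsupp : tsupport (H.ballTranslate ρ r x) ⊆ quasiBall ρ x (c₁ * r))
    (hgrowth : ∀ y, lam (quasiBall ρ x r) * H.ballTranslate ρ r x y ≤
      c₂ * lam (quasiBall ρ H.e r)) :
    H.lconv lam ((quasiBall ρ H.e r).indicator 1) F x * lam (quasiBall ρ x r) ≤
      C * c₂ * lam (quasiBall ρ H.e r) * ∫⁻ y in quasiBall ρ x (c₁ * r), F y ∂lam := by
  have hfin : lam (quasiBall ρ x r) ≠ ∞ := (hd.measure_lt_top x r).ne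
  have h1 : H.lconv lam ((quasiBall ρ H.e r).indicator 1) F x ≤
      C * ∫⁻ y, H.ballTranslate ρ r x y * F y ∂lam := by
    refine le_trans (lintegral_mono fun y => ?_)
      (lintegral_comp_inv_le hC fun y => H.ballTranslate ρ r x y * F y)
    rw [ballTranslate, H.inv_inv]
    rfl
  have h2 : lam (quasiBall ρ x r) * ∫⁻ y, H.ballTranslate ρ r x y * F y ∂lam ≤
      c₂ * lam (quasiBall ρ H.e r) * ∫⁻ y in quasiBall ρ x (c₁ * r), F y ∂lam := by
    rw [← lintegral_const_mul' _ _ hfin, ← lintegral_indicator₀ (hd.nullMeasurableSet_ball _ _),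
      ← lintegral_const_mul' _ _ (ENNReal.mul_ne_top ENNReal.coe_ne_top
        (hd.measure_lt_top _ _).ne)]
    refine lintegral_mono fun y => ?_
    by_cases hy : y ∈ quasiBall ρ x (c₁ * r)
    · rw [indicator_of_mem hy, ← mul_assoc]
      exact mul_le_mul_left (hgrowth y) _
    · have h0 : H.ballTranslate ρ r x y = 0 := by
        by_contra hne
        exact hy (hsupp (subset_tsupport _ hne))
      simp [h0]
  calc H.lconv lam ((quasiBall ρ H.e r).indicator 1) F x * lam (quasiBall ρ x r)
      ≤ (C * ∫⁻ y, H.ballTranslate ρ r x y * F y ∂lam) * lam (quasiBall ρ x r) :=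
        mul_le_mul_left h1 _
    _ = C * (lam (quasiBall ρ x r) * ∫⁻ y, H.ballTranslate ρ r x y * F y ∂lam) := by ring
    _ ≤ C * (c₂ * lam (quasiBall ρ H.e r) * ∫⁻ y in quasiBall ρ x (c₁ * r), F y ∂lam) :=
        mul_le_mul_right h2 _
    _ = _ := by ring

/-- The maximal function formed with the normalized dyadic balls around the identity. -/
noncomputable def dyadicMaximal (H : Hypergroup K) (ρ : K → K → ℝ) (lam : Measure K)
    (F : K → ℝ≥0∞) (x : K) : ℝ≥0∞ :=
  ⨆ j : ℤ, H.lconv lam ((quasiBall ρ H.e (2 ^ j)).indicator 1) F x /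
    lam (quasiBall ρ H.e (2 ^ j))

theorem IsHaar.aemeasurable_dyadicMaximal [SigmaFinite lam] (hlam : H.IsHaar lam)
    (hd : IsDoublingMeasure ρ lam) (hF : Measurable F) :
    AEMeasurable (H.dyadicMaximal ρ lam F) lam :=
  AEMeasurable.iSup fun _ =>
    (hlam.aemeasurable_lconv (aemeasurable_indicator_quasiBall hd _ _) hF).div_const _

theorem lconv_le_mul_dyadicMaximal (hd : IsDoublingMeasure ρ lam) (F : K → ℝ≥0∞) (x : K) (j : ℤ) :
    H.lconv lam ((quasiBall ρ H.e (2 ^ j)).indicator 1) F x ≤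
      lam (quasiBall ρ H.e (2 ^ j)) * H.dyadicMaximal ρ lam F x := by
  have h2 : (0 : ℝ) < 2 ^ j := by positivity
  rw [← ENNReal.div_le_iff' (hd.measure_pos _ h2).ne' (hd.measure_lt_top _ _).ne]
  exact le_iSup (fun j : ℤ => H.lconv lam ((quasiBall ρ H.e (2 ^ j)).indicator 1) F x /
    lam (quasiBall ρ H.e (2 ^ j))) j

/-- The maximal function is bounded on `L^p`. -/
theorem IsHaar.exists_lintegral_dyadicMaximal_rpow_le (hcomm : H.IsCommutative)
    (hlam : H.IsHaar lam) (hρ : IsQuasiMetric ρ) (hd : IsDoublingMeasure ρ lam)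
    (hsupp : H.SupportCondition ρ) {N : ℝ} (hgrowth : H.GrowthCondition ρ lam N) {p : ℝ}
    (hp : 1 < p) :
    ∃ C : ℝ≥0, ∀ f : K → ℝ≥0, Measurable f →
      ∫⁻ x, H.dyadicMaximal ρ lam (fun y => f y) x ^ p ∂lam ≤
        C * ∫⁻ x, (f x : ℝ≥0∞) ^ p ∂lam := by
  have : Nonempty K := ⟨H.e⟩
  have : SigmaFinite lam := hd.sigmaFinite
  obtain ⟨C₀, hC₀⟩ := hlam.exists_map_inv_le hcomm hρ hd hsupp
  obtain ⟨c₁, hc₁, hs⟩ := hsupp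
  obtain ⟨c₂, c₃, -, -, hg⟩ := hgrowth
  obtain ⟨C₁, hC₁⟩ := hd.exists_measure_mul_le c₁
  obtain ⟨C₂, hC₂⟩ := hd.exists_weak_type hρ
  have hB0 : ∀ j : ℤ, lam (quasiBall ρ H.e (2 ^ j)) ≠ 0 := fun j =>
    (hd.measure_pos _ (by positivity)).ne'
  have hBt : ∀ j : ℤ, lam (quasiBall ρ H.e (2 ^ j)) ≠ ∞ := fun j => (hd.measure_lt_top _ _).ne
  have hweak : ∀ f : K → ℝ≥0, Measurable f → ∀ t : ℝ, 0 < t →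
      ENNReal.ofReal t * lam {x | ENNReal.ofReal t < H.dyadicMaximal ρ lam (fun y => f y) x} ≤
        (2 * (C₂ * (C₁ * (C₀ * c₂))) : ℝ≥0) * ∫⁻ x in {x | t < 2 * f x}, f x ∂lam := by
    intro f hf t ht
    have hlev : MeasurableSet {x | t < 2 * (f x : ℝ)} :=
      measurableSet_lt measurable_const (hf.coe_nnreal_real.const_mul 2)
    -- `F₁` keeps the values of `f` above `t / 2`; the remainder adds at most `t / 2` to any
    -- normalized average.
    set F₁ : K → ℝ≥0∞ := {x | t < 2 * (f x : ℝ)}.indicator fun x => f x with hF₁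
    have hF₁m : Measurable F₁ := hf.coe_nnreal_ennreal.indicator hlev
    -- The covering argument needs bounded radii, hence the cap `j ≤ J`, removed afterwards by
    -- continuity from below.
    set S : ℤ → Set K := fun J => {x | ∃ j ≤ J, ENNReal.ofReal t / 2 <
      H.lconv lam ((quasiBall ρ H.e (2 ^ j)).indicator 1) F₁ x /
        lam (quasiBall ρ H.e (2 ^ j))} with hS
    have hsub : {x | ENNReal.ofReal t < H.dyadicMaximal ρ lam (fun y => f y) x} ⊆
        ⋃ J, S J := by
      intro x hx
      rw [mem_ofPred_eq, dyadicMaximal, lt_iSup_iff] at hx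
      obtain ⟨j, hj⟩ := hx
      refine mem_iUnion.2 ⟨j, j, le_rfl, ?_⟩
      by_contra hcon
      refine hj.not_ge ?_
      rw [not_lt] at hcon
      have hle : ∀ y, (f y : ℝ≥0∞) ≤ F₁ y + ENNReal.ofReal t / 2 := by
        intro y
        by_cases hy : t < 2 * (f y : ℝ)
        · rw [hF₁, indicator_of_mem (show y ∈ {x | t < 2 * (f x : ℝ)} from hy)]
          exact le_self_add
        · refine le_trans ?_ le_add_self
          rw [ENNReal.le_div_iff_mul_le (by simp) (by simp), ← ENNReal.ofReal_coe_nnreal,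
            ← ENNReal.ofReal_ofNat 2, ← ENNReal.ofReal_mul (NNReal.coe_nonneg _)]
          exact ENNReal.ofReal_le_ofReal (by linarith)
      have hw := aemeasurable_indicator_quasiBall hd H.e (2 ^ j)
      calc H.lconv lam ((quasiBall ρ H.e (2 ^ j)).indicator 1) (fun y => f y) x /
            lam (quasiBall ρ H.e (2 ^ j))
          ≤ (H.lconv lam ((quasiBall ρ H.e (2 ^ j)).indicator 1) F₁ x +
              lam (quasiBall ρ H.e (2 ^ j)) * (ENNReal.ofReal t / 2)) /
              lam (quasiBall ρ H.e (2 ^ j)) := by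
            refine ENNReal.div_le_div_right ?_ _
            rw [← lintegral_indicator_quasiBall hd]
            refine le_trans ?_ (add_le_add_right (hlam.lconv_le_const_mul hw
              (F := fun _ => ENNReal.ofReal t / 2) (fun _ => le_rfl) x) _)
            rw [← hlam.lconv_add hw hF₁m]
            exact lconv_mono hle x
        _ = H.lconv lam ((quasiBall ρ H.e (2 ^ j)).indicator 1) F₁ x /
              lam (quasiBall ρ H.e (2 ^ j)) + ENNReal.ofReal t / 2 := by
            rw [ENNReal.add_div, mul_comm (lam _), ENNReal.mul_div_cancel_right (hB0 j) (hBt j)]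
        _ ≤ ENNReal.ofReal t / 2 + ENNReal.ofReal t / 2 := add_le_add_left hcon _
        _ = ENNReal.ofReal t := ENNReal.add_halves _
    have hmono : Monotone S := fun J J' hJ x ⟨j, hj, hx⟩ => ⟨j, hj.trans hJ, hx⟩
    have hSJ : ∀ J, ENNReal.ofReal t / 2 * lam (S J) ≤
        C₂ * ∫⁻ y, (C₁ * (C₀ * c₂) : ℝ≥0) * F₁ y ∂lam := by
      intro J
      refine hC₂ _ _ _ (c₁ * 2 ^ J) fun x ⟨j, hj, hx⟩ => ⟨c₁ * 2 ^ j, by positivity, ?_, ?_⟩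
      · exact mul_le_mul_of_nonneg_left (zpow_le_zpow_right₀ one_le_two hj) hc₁.le
      · have h2 : (0 : ℝ) < 2 ^ j := by positivity
        rw [lintegral_const_mul' _ _ ENNReal.coe_ne_top]
        calc ENNReal.ofReal t / 2 * lam (quasiBall ρ x (c₁ * 2 ^ j))
            ≤ H.lconv lam ((quasiBall ρ H.e (2 ^ j)).indicator 1) F₁ x /
                lam (quasiBall ρ H.e (2 ^ j)) * (C₁ * lam (quasiBall ρ x (2 ^ j))) :=
              mul_le_mul' hx.le (hC₁ x _ h2)
          _ = C₁ * (H.lconv lam ((quasiBall ρ H.e (2 ^ j)).indicator 1) F₁ x *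
                lam (quasiBall ρ x (2 ^ j))) / lam (quasiBall ρ H.e (2 ^ j)) := by
              rw [ENNReal.div_eq_inv_mul, ENNReal.div_eq_inv_mul]
              ring
          _ ≤ C₁ * (C₀ * c₂ * lam (quasiBall ρ H.e (2 ^ j)) *
                ∫⁻ y in quasiBall ρ x (c₁ * 2 ^ j), F₁ y ∂lam) /
                lam (quasiBall ρ H.e (2 ^ j)) := by
              refine ENNReal.div_le_div_right (mul_le_mul_right ?_ _) _
              exact lconv_indicator_mul_le hd hC₀ (hs x _ h2) fun y => (hg x y _ h2).1
          _ = lam (quasiBall ρ H.e (2 ^ j)) * (C₁ * (C₀ * c₂) *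
                ∫⁻ y in quasiBall ρ x (c₁ * 2 ^ j), F₁ y ∂lam) /
                lam (quasiBall ρ H.e (2 ^ j)) := by
              congr 1
              ring
          _ = _ := by
              rw [mul_comm (lam _), ENNReal.mul_div_cancel_right (hB0 j) (hBt j)]
              push_cast
              rfl
    have hfinal : ENNReal.ofReal t / 2 * lam (⋃ J, S J) ≤
        C₂ * ∫⁻ y, (C₁ * (C₀ * c₂) : ℝ≥0) * F₁ y ∂lam := by
      rw [hmono.measure_iUnion, ENNReal.mul_iSup]
      exact iSup_le hSJ
    calc ENNReal.ofReal t * lam {x | ENNReal.ofReal t < H.dyadicMaximal ρ lam (fun y => f y) x}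
        ≤ ENNReal.ofReal t * lam (⋃ J, S J) := mul_le_mul_right (measure_mono hsub) _
      _ = 2 * (ENNReal.ofReal t / 2 * lam (⋃ J, S J)) := by
          rw [← mul_assoc, ENNReal.mul_div_cancel (by simp) (by simp)]
      _ ≤ 2 * (C₂ * ∫⁻ y, (C₁ * (C₀ * c₂) : ℝ≥0) * F₁ y ∂lam) := mul_le_mul_right hfinal _
      _ = _ := by
          rw [lintegral_const_mul' _ _ ENNReal.coe_ne_top, hF₁, lintegral_indicator hlev]
          push_cast
          ring
  refine ⟨((2 * (C₂ * (C₁ * (C₀ * c₂))) : ℝ≥0) * ENNReal.ofReal p *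
    (ENNReal.ofReal (p - 1))⁻¹ * 2 ^ (p - 1)).toNNReal, fun f hf => ?_⟩
  rw [ENNReal.coe_toNNReal]
  · exact lintegral_rpow_le_of_weak_type (hlam.aemeasurable_dyadicMaximal hd
      hf.coe_nnreal_ennreal) hf hp (hweak f hf)
  · have hp1 : 0 < p - 1 := sub_pos.2 hp
    refine ENNReal.mul_ne_top (ENNReal.mul_ne_top (ENNReal.mul_ne_top ENNReal.coe_ne_top
      ENNReal.ofReal_ne_top) ?_) (ENNReal.rpow_ne_top_of_nonneg hp1.le ENNReal.ofNat_ne_top)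
    simpa using hp

end Hypergroup

/-! ### The Riesz kernel and Hedberg's inequality. -/

theorem IsDoublingMeasure.aemeasurable_dist {K : Type*} [MeasurableSpace K] {ρ : K → K → ℝ}
    {lam : Measure K} (hd : IsDoublingMeasure ρ lam) (x : K) : AEMeasurable (ρ x) lam := by
  have h : @Measurable (NullMeasurableSpace K lam) ℝ _ _ (ρ x) :=
    measurable_of_Iio fun r => hd.nullMeasurableSet_ball x r
  exact NullMeasurable.aemeasurable fun _ hs => h hs

namespace Hypergroup

variable {K : Type*} [TopologicalSpace K] [T2Space K] [LocallyCompactSpace K]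
  [MeasurableSpace K] [BorelSpace K] {H : Hypergroup K} {lam : Measure K} {ρ : K → K → ℝ}
  {N α p q : ℝ}

theorem aemeasurable_rieszKernel (hd : IsDoublingMeasure ρ lam) :
    AEMeasurable (H.rieszKernel ρ N α) lam :=
  (hd.aemeasurable_dist H.e).ennreal_ofReal.pow_const _

theorem GrowthCondition.exists_measure_le (hg : H.GrowthCondition ρ lam N) :
    ∃ c : ℝ≥0, ∀ r : ℝ, 0 < r → lam (quasiBall ρ H.e r) ≤ c * ENNReal.ofReal (r ^ N) := by
  obtain ⟨c₂, c₃, h₂, -, h⟩ := hg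
  refine ⟨c₃ / c₂, fun r hr => ?_⟩
  have h1 := (h H.e H.e r hr).2
  have hc : (c₂ : ℝ≥0∞) ≠ 0 := by simpa using h₂.ne'
  rw [mul_comm, ← ENNReal.le_div_iff_mul_le (Or.inl hc) (Or.inl ENNReal.coe_ne_top)] at h1
  refine h1.trans_eq ?_
  rw [ENNReal.coe_div h₂.ne', ENNReal.div_eq_inv_mul, ENNReal.div_eq_inv_mul, mul_assoc]

theorem ofReal_two_zpow_rpow (j : ℤ) (s : ℝ) :
    ENNReal.ofReal (((2 : ℝ) ^ j) ^ s) = (2 : ℝ≥0∞) ^ (j * s) := by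
  rw [← ENNReal.ofReal_rpow_of_pos (by positivity), ENNReal.rpow_mul, ← Real.rpow_intCast,
    ← ENNReal.ofReal_rpow_of_pos two_pos, ENNReal.ofReal_ofNat]

/-- The singleton lies in balls of measure `O(r ^ N)` with `r → 0`, so the infinite value of the
kernel at `e` is harmless. -/
theorem GrowthCondition.ae_ne_e (hg : H.GrowthCondition ρ lam N) (hρ : IsQuasiMetric ρ)
    (hN : 0 < N) : ∀ᵐ y ∂lam, y ≠ H.e := by
  obtain ⟨c, hc⟩ := hg.exists_measure_le
  have hle : ∀ n : ℕ, lam {H.e} ≤ c * ENNReal.ofReal ((1 / ((n : ℝ) + 1)) ^ N) := fun n =>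
    (measure_mono (singleton_subset_iff.2 (hρ.mem_quasiBall_self H.e (by positivity)))).trans
      (hc _ (by positivity))
  have ht : Tendsto (fun n : ℕ => (c : ℝ≥0∞) * ENNReal.ofReal ((1 / ((n : ℝ) + 1)) ^ N)) atTop
      (𝓝 (c * ENNReal.ofReal (0 ^ N))) :=
    ENNReal.Tendsto.const_mul (ENNReal.tendsto_ofReal
      (tendsto_one_div_add_atTop_nhds_zero_nat.rpow_const (Or.inr hN.le)))
      (Or.inr ENNReal.coe_ne_top)
  rw [Real.zero_rpow hN.ne', ENNReal.ofReal_zero, mul_zero] at ht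
  exact measure_eq_zero_iff_ae_notMem.1 (le_antisymm (ge_of_tendsto' ht hle) zero_le)

/-- The Riesz kernel is dominated by a dyadic sum of indicators of balls. -/
theorem rieszKernel_le_tsum (hρ : IsQuasiMetric ρ) (hαN : α < N) {y : K} (hy : y ≠ H.e) :
    H.rieszKernel ρ N α y ≤ ∑' j : ℤ, (2 : ℝ≥0∞) ^ (((j : ℝ) - 1) * (α - N)) *
      (quasiBall ρ H.e (2 ^ j)).indicator 1 y := by
  have h0 : 0 < ρ H.e y :=
    lt_of_le_of_ne (hρ.nonneg _ _) fun h => hy ((hρ.eq_zero_iff _ _).1 h.symm).symm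
  obtain ⟨j, hj1, hj2⟩ := exists_mem_Ico_zpow h0 (one_lt_two (α := ℝ))
  -- One term suffices: `2 ^ j ≤ ρ(e, y) < 2 ^ (j + 1)` puts `y` in the ball of index `j + 1`, whose
  -- coefficient is `2 ^ (j(α - N))`.
  refine le_trans ?_ (ENNReal.le_tsum (j + 1))
  rw [indicator_of_mem (show y ∈ quasiBall ρ H.e (2 ^ (j + 1)) from hj2), Pi.one_apply, mul_one,
    rieszKernel, ENNReal.ofReal_rpow_of_pos h0, Int.cast_add, Int.cast_one, add_sub_cancel_right,
    ← ofReal_two_zpow_rpow]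
  exact ENNReal.ofReal_le_ofReal
    (Real.rpow_le_rpow_of_nonpos (by positivity) hj1 (sub_neg.2 hαN).le)

theorem two_rpow_ne_top (s : ℝ) : (2 : ℝ≥0∞) ^ s ≠ ∞ :=
  ENNReal.rpow_ne_top_of_ne_zero two_ne_zero ENNReal.ofNat_ne_top

/-- The translates of the Riesz kernel are finite almost everywhere. -/
theorem IsHaar.ae_translate_rieszKernel_lt_top (hlam : H.IsHaar lam) (hρ : IsQuasiMetric ρ)
    (hd : IsDoublingMeasure ρ lam) (hg : H.GrowthCondition ρ lam N) (hα : 0 < α) (hαN : α < N)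
    (x : K) : ∀ᵐ y ∂lam, H.translate x (H.rieszKernel ρ N α) y < ∞ := by
  obtain ⟨c, hc⟩ := hg.exists_measure_le
  obtain ⟨C, hC⟩ := exists_tsum_int_min_le hα (sub_pos.2 hαN)
  set B := quasiBall ρ H.e 1 with hB
  set k := H.rieszKernel ρ N α with hk
  have hkm : AEMeasurable (B.indicator k) lam :=
    (aemeasurable_rieszKernel hd).indicator₀ (hd.nullMeasurableSet_ball _ _)
  have hk1 : ∀ y, k y ≤ B.indicator k y + 1 := by
    intro y
    by_cases hy : y ∈ B
    · rw [indicator_of_mem hy]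
      exact le_self_add
    · rw [indicator_of_notMem hy, zero_add, hk, rieszKernel]
      have h1 : 1 ≤ ρ H.e y := not_lt.1 hy
      rw [ENNReal.ofReal_rpow_of_pos (one_pos.trans_le h1), ENNReal.ofReal_le_one]
      exact Real.rpow_le_one_of_one_le_of_nonpos h1 (sub_neg.2 hαN).le
  -- Small dyadic balls are measured by the growth bound and large ones by `λ(B)`; both resulting
  -- series are geometric.
  have hint : ∫⁻ y, B.indicator k y ∂lam ≠ ∞ := by
    have hle : ∫⁻ y, B.indicator k y ∂lam ≤ ∑' j : ℤ,
        min ((2 : ℝ≥0∞) ^ (j * α) * (2 ^ (N - α) * c))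
          (2 ^ (-(j * (N - α))) * (2 ^ (N - α) * c)) := by
      calc ∫⁻ y, B.indicator k y ∂lam
          ≤ ∫⁻ y, ∑' j : ℤ, (2 : ℝ≥0∞) ^ (((j : ℝ) - 1) * (α - N)) *
              (B ∩ quasiBall ρ H.e (2 ^ j)).indicator 1 y ∂lam := by
            refine lintegral_mono_ae ?_
            filter_upwards [hg.ae_ne_e hρ (hα.trans hαN)] with y hy
            by_cases hyB : y ∈ B
            · rw [indicator_of_mem hyB]
              refine (rieszKernel_le_tsum hρ hαN hy).trans_eq (tsum_congr fun j => ?_)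
              rw [inter_indicator_one, Pi.mul_apply, indicator_of_mem hyB, Pi.one_apply, one_mul]
            · simp [hyB]
        _ = ∑' j : ℤ, (2 : ℝ≥0∞) ^ (((j : ℝ) - 1) * (α - N)) *
              lam (B ∩ quasiBall ρ H.e (2 ^ j)) := by
            have hnm : ∀ j : ℤ, NullMeasurableSet (B ∩ quasiBall ρ H.e (2 ^ j)) lam := fun j =>
              (hd.nullMeasurableSet_ball _ _).inter (hd.nullMeasurableSet_ball _ _)
            have ham : ∀ j : ℤ, AEMeasurable
                ((B ∩ quasiBall ρ H.e (2 ^ j)).indicator (1 : K → ℝ≥0∞)) lam := fun j =>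
              aemeasurable_one.indicator₀ (hnm j)
            rw [lintegral_tsum fun j => (ham j).const_mul _]
            refine tsum_congr fun j => ?_
            rw [lintegral_const_mul'' _ (ham j),
              lintegral_indicator_one₀ (hnm j)]
        _ ≤ _ := by
            refine ENNReal.tsum_le_tsum fun j => le_min ?_ ?_
            · have h1 := (measure_mono (inter_subset_right (s := B))).trans
                (hc (2 ^ j) (by positivity))
              rw [ofReal_two_zpow_rpow] at h1
              refine (mul_le_mul_right h1 _).trans_eq ?_
              rw [show ((j : ℝ) - 1) * (α - N) = j * α + (N - α) + -(j * N) by ring,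
                ENNReal.rpow_add _ _ two_ne_zero ENNReal.ofNat_ne_top,
                ENNReal.rpow_add _ _ two_ne_zero ENNReal.ofNat_ne_top, ENNReal.rpow_neg]
              have h2 : ((2 : ℝ≥0∞) ^ ((j : ℝ) * N))⁻¹ * 2 ^ ((j : ℝ) * N) = 1 :=
                ENNReal.inv_mul_cancel (ENNReal.rpow_pos two_pos ENNReal.ofNat_ne_top).ne'
                  (two_rpow_ne_top _)
              calc _ = 2 ^ ((j : ℝ) * α) * 2 ^ (N - α) * (c : ℝ≥0∞) *
                    (((2 : ℝ≥0∞) ^ ((j : ℝ) * N))⁻¹ * 2 ^ ((j : ℝ) * N)) := by ring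
                _ = _ := by rw [h2]; ring
            · have h1 := (measure_mono (inter_subset_left (t := quasiBall ρ H.e (2 ^ j)))).trans
                (hc 1 one_pos)
              rw [Real.one_rpow, ENNReal.ofReal_one, mul_one] at h1
              refine (mul_le_mul_right h1 _).trans_eq ?_
              rw [show ((j : ℝ) - 1) * (α - N) = -(j * (N - α)) + (N - α) by ring,
                ENNReal.rpow_add _ _ two_ne_zero ENNReal.ofNat_ne_top, mul_assoc]
    refine ne_top_of_le_ne_top ?_ (hle.trans (hC _ _))
    have hfin : (2 : ℝ≥0∞) ^ (N - α) * c ≠ ∞ :=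
      ENNReal.mul_ne_top (two_rpow_ne_top _) ENNReal.coe_ne_top
    have hNα : 0 < N - α := sub_pos.2 hαN
    exact ENNReal.mul_ne_top ENNReal.coe_ne_top (ENNReal.mul_ne_top
      (ENNReal.rpow_ne_top_of_nonneg (by positivity) hfin)
      (ENNReal.rpow_ne_top_of_nonneg (by positivity) hfin))
  rw [← hlam.lintegral_translate_ae hkm x] at hint
  filter_upwards [ae_lt_top' (hlam.aemeasurable_translate hkm x) hint] with y hy
  refine (lintegral_mono hk1).trans_lt ?_
  rw [lintegral_add_right _ measurable_const, lintegral_const, measure_univ, one_mul]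
  exact ENNReal.add_lt_top.2 ⟨hy, ENNReal.one_lt_top⟩

/-- The Hardy–Littlewood–Sobolev inequality for nonnegative functions. -/
theorem IsHaar.exists_lintegral_lconv_rieszKernel_le (hcomm : H.IsCommutative)
    (hlam : H.IsHaar lam) (hρ : IsQuasiMetric ρ) (hd : IsDoublingMeasure ρ lam)
    (hsupp : H.SupportCondition ρ) (hg : H.GrowthCondition ρ lam N)
    (hα : 0 < α) (hαN : α < N) (hp : 1 < p) (hpN : p < N / α) (hpq : 1 / p - 1 / q = α / N) :
    ∃ C : ℝ≥0, ∀ f : K → ℝ≥0, Measurable f →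
      ∫⁻ x, H.lconv lam (H.rieszKernel ρ N α) (fun y => f y) x ^ q ∂lam ≤
        C * (∫⁻ x, (f x : ℝ≥0∞) ^ p ∂lam) ^ (q / p) := by
  have hN : 0 < N := hα.trans hαN
  have hp0 : 0 < p := one_pos.trans hp
  have hb : 0 < N / p - α := by
    rw [lt_div_iff₀ hα] at hpN
    rw [sub_pos, lt_div_iff₀ hp0]
    linarith
  have hq : 1 / q = (N / p - α) / N := by
    rw [show 1 / q = 1 / p - α / N by linarith]
    field_simp
  have hq0 : 0 < q := one_div_pos.1 (hq ▸ div_pos hb hN)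
  -- Since `α + (N/p - α) = N/p`, the interpolation exponents multiplied by `q` become `p` and `q -
  -- p`.
  have hu : (N / p - α) / (α + (N / p - α)) * q = p := by
    have h1 : (N / p - α) * q = N := by
      have h2 : 1 / q * q = 1 := by field_simp
      rw [hq] at h2
      field_simp at h2 ⊢
      linarith
    rw [add_sub_cancel, div_mul_eq_mul_div, h1]
    field_simp
  have hv : α / (α + (N / p - α)) * q = q - p := by
    rw [show α / (α + (N / p - α)) = 1 - (N / p - α) / (α + (N / p - α)) by
      rw [add_sub_cancel]; field_simp; ring, sub_mul, hu, one_mul]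
  have hqp : 0 < q - p := hv ▸ by
    rw [add_sub_cancel]
    positivity
  obtain ⟨C₀, hC₀⟩ := hlam.exists_map_inv_le hcomm hρ hd hsupp
  obtain ⟨c, hc⟩ := hg.exists_measure_le
  obtain ⟨C₁, hC₁⟩ := exists_tsum_int_min_le hα hb
  obtain ⟨C₂, hC₂⟩ := hlam.exists_lintegral_dyadicMaximal_rpow_le hcomm hρ hd hsupp hg hp
  set D₁ : ℝ≥0∞ := 2 ^ (N - α) * c with hD₁
  set D₂ : ℝ≥0∞ := 2 ^ (N - α) * (c : ℝ≥0∞) ^ (1 - 1 / p) * (C₀ : ℝ≥0∞) ^ (1 / p) with hD₂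
  have hp1 : 0 ≤ 1 - 1 / p := sub_nonneg.2 ((div_le_one hp0).2 hp.le)
  have hD₁t : D₁ ≠ ∞ := ENNReal.mul_ne_top (two_rpow_ne_top _) ENNReal.coe_ne_top
  have hD₂t : D₂ ≠ ∞ := ENNReal.mul_ne_top (ENNReal.mul_ne_top (two_rpow_ne_top _)
    (ENNReal.rpow_ne_top_of_nonneg hp1 ENNReal.coe_ne_top))
    (ENNReal.rpow_ne_top_of_nonneg (by positivity) ENNReal.coe_ne_top)
  -- Hedberg's pointwise inequality, raised to the power `q`.
  have hpoint : ∀ f : K → ℝ≥0, Measurable f → ∀ x,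
      H.lconv lam (H.rieszKernel ρ N α) (fun y => f y) x ^ q ≤
        (C₁ ^ q * D₁ ^ p * D₂ ^ (q - p) * (∫⁻ x, (f x : ℝ≥0∞) ^ p ∂lam) ^ ((q - p) / p)) *
          H.dyadicMaximal ρ lam (fun y => f y) x ^ p := by
    intro f hf x
    set I := ∫⁻ x, (f x : ℝ≥0∞) ^ p ∂lam with hI
    set m := H.dyadicMaximal ρ lam (fun y => f y) x with hm
    have hbm := fun j : ℤ => aemeasurable_indicator_quasiBall hd H.e (2 ^ j)
    have hcj : ∀ j : ℤ, lam (quasiBall ρ H.e (2 ^ j)) ≤ c * 2 ^ (j * N) := fun j => by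
      rw [← ofReal_two_zpow_rpow]
      exact hc _ (by positivity)
    have h1 : H.lconv lam (H.rieszKernel ρ N α) (fun y => f y) x ≤
        ∑' j : ℤ, min ((2 : ℝ≥0∞) ^ (j * α) * (D₁ * m))
          (2 ^ (-(j * (N / p - α))) * (D₂ * I ^ (1 / p))) := by
      refine (hlam.lconv_le_tsum hbm hf.coe_nnreal_ennreal
        ((hg.ae_ne_e hρ hN).mono fun y hy => rieszKernel_le_tsum hρ hαN hy) x).trans ?_
      refine ENNReal.tsum_le_tsum fun j => le_min ?_ ?_
      · calc (2 : ℝ≥0∞) ^ (((j : ℝ) - 1) * (α - N)) *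
              H.lconv lam ((quasiBall ρ H.e (2 ^ j)).indicator 1) (fun y => f y) x
            ≤ (2 : ℝ≥0∞) ^ (((j : ℝ) - 1) * (α - N)) * ((c * 2 ^ (j * N)) * m) :=
              mul_le_mul_right ((lconv_le_mul_dyadicMaximal hd _ x j).trans
                (mul_le_mul_left (hcj j) _)) _
          _ = (2 ^ (((j : ℝ) - 1) * (α - N)) * 2 ^ (j * N)) * (c * m) := by ring
          _ = 2 ^ (j * α) * (D₁ * m) := by
              rw [← ENNReal.rpow_add _ _ two_ne_zero ENNReal.ofNat_ne_top, hD₁,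
                show ((j : ℝ) - 1) * (α - N) + j * N = j * α + (N - α) by ring,
                ENNReal.rpow_add _ _ two_ne_zero ENNReal.ofNat_ne_top]
              ring
      · calc (2 : ℝ≥0∞) ^ (((j : ℝ) - 1) * (α - N)) *
              H.lconv lam ((quasiBall ρ H.e (2 ^ j)).indicator 1) (fun y => f y) x
            ≤ (2 : ℝ≥0∞) ^ (((j : ℝ) - 1) * (α - N)) *
                ((c * 2 ^ (j * N)) ^ (1 - 1 / p) * (C₀ * I) ^ (1 / p)) := by
              refine mul_le_mul_right ((hlam.lconv_le_holder hC₀ (hbm j) (fun y => ?_)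
                hf.coe_nnreal_ennreal hp x).trans (mul_le_mul_left
                  (ENNReal.rpow_le_rpow ?_ hp1) _)) _
              · exact indicator_le_self' (fun _ _ => zero_le) y
              · rw [lintegral_indicator_quasiBall hd]
                exact hcj j
          _ = (2 ^ (((j : ℝ) - 1) * (α - N)) * 2 ^ (j * N * (1 - 1 / p))) *
                (c ^ (1 - 1 / p) * C₀ ^ (1 / p) * I ^ (1 / p)) := by
              rw [ENNReal.mul_rpow_of_nonneg _ _ hp1,
                ENNReal.mul_rpow_of_nonneg _ _ (by positivity : 0 ≤ 1 / p), ← ENNReal.rpow_mul]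
              ring
          _ = 2 ^ (-(j * (N / p - α))) * (D₂ * I ^ (1 / p)) := by
              rw [← ENNReal.rpow_add _ _ two_ne_zero ENNReal.ofNat_ne_top, hD₂,
                show ((j : ℝ) - 1) * (α - N) + j * N * (1 - 1 / p) =
                  -(j * (N / p - α)) + (N - α) by ring,
                ENNReal.rpow_add _ _ two_ne_zero ENNReal.ofNat_ne_top]
              ring
    calc H.lconv lam (H.rieszKernel ρ N α) (fun y => f y) x ^ q
        ≤ (C₁ * ((D₁ * m) ^ ((N / p - α) / (α + (N / p - α))) *
            (D₂ * I ^ (1 / p)) ^ (α / (α + (N / p - α))))) ^ q :=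
          ENNReal.rpow_le_rpow (h1.trans (hC₁ _ _)) hq0.le
      _ = C₁ ^ q * ((D₁ * m) ^ p * (D₂ * I ^ (1 / p)) ^ (q - p)) := by
          rw [ENNReal.mul_rpow_of_nonneg _ _ hq0.le, ENNReal.mul_rpow_of_nonneg _ _ hq0.le,
            ← ENNReal.rpow_mul, ← ENNReal.rpow_mul, hu, hv]
      _ = _ := by
          rw [ENNReal.mul_rpow_of_nonneg _ _ hp0.le, ENNReal.mul_rpow_of_nonneg _ _ hqp.le,
            ← ENNReal.rpow_mul, one_div_mul_eq_div]
          ring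
  refine ⟨((C₁ : ℝ≥0∞) ^ q * D₁ ^ p * D₂ ^ (q - p) * C₂).toNNReal, fun f hf => ?_⟩
  have hKt : (C₁ : ℝ≥0∞) ^ q * D₁ ^ p * D₂ ^ (q - p) ≠ ∞ :=
    ENNReal.mul_ne_top (ENNReal.mul_ne_top (ENNReal.rpow_ne_top_of_nonneg hq0.le
      ENNReal.coe_ne_top) (ENNReal.rpow_ne_top_of_nonneg hp0.le hD₁t))
      (ENNReal.rpow_ne_top_of_nonneg hqp.le hD₂t)
  rw [ENNReal.coe_toNNReal (ENNReal.mul_ne_top hKt ENNReal.coe_ne_top)]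
  have : Nonempty K := ⟨H.e⟩
  have : SigmaFinite lam := hd.sigmaFinite
  refine (lintegral_mono (hpoint f hf)).trans ?_
  rw [lintegral_const_mul'' _ ((hlam.aemeasurable_dyadicMaximal hd
    hf.coe_nnreal_ennreal).pow_const p)]
  refine (mul_le_mul_right (hC₂ f hf) _).trans_eq ?_
  rw [show q / p = (q - p) / p + 1 by field_simp; ring,
    ENNReal.rpow_add_of_nonneg _ _ (by positivity) zero_le_one, ENNReal.rpow_one]
  ring

end Hypergroup

/-! ### Passage to real-valued functions. -/

theorem mainTheorem2 {K : Type*} [TopologicalSpace K] [T2Space K] [LocallyCompactSpace K]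
    [MeasurableSpace K] [BorelSpace K] (H : Hypergroup K) (hcomm : H.IsCommutative)
    (lam : Measure K) (hlam : H.IsHaar lam)
    (ρ : K → K → ℝ) (hρ : IsQuasiMetric ρ) (hdoubling : IsDoublingMeasure ρ lam)
    (N : ℝ) (hsupp : H.SupportCondition ρ) (hgrowth : H.GrowthCondition ρ lam N)
    (α p q : ℝ) (hα : 0 < α) (hαN : α < N) (hp : 1 < p) (hpN : p < N / α)
    (hpq : 1 / p - 1 / q = α / N) :
    (∀ x, ∀ᵐ y ∂lam, H.translate x (H.rieszKernel ρ N α) y < ∞) ∧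
    ∃ C : ℝ≥0, ∀ f : K → ℝ, MemLp f (ENNReal.ofReal p) lam →
      (∀ᵐ x ∂lam, Integrable
        (fun y => (H.translate x (H.rieszKernel ρ N α) y).toReal * f (H.inv y)) lam) ∧
      MemLp (H.rieszPotential ρ lam N α f) (ENNReal.ofReal q) lam ∧
      eLpNorm (H.rieszPotential ρ lam N α f) (ENNReal.ofReal q) lam ≤
        C * eLpNorm f (ENNReal.ofReal p) lam := by
  refine ⟨hlam.ae_translate_rieszKernel_lt_top hρ hdoubling hgrowth hα hαN, ?_⟩
  obtain ⟨C, hC⟩ := hlam.exists_lintegral_lconv_rieszKernel_le hcomm hρ hdoubling hsupp hgrowth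
    hα hαN hp hpN hpq
  have : Nonempty K := ⟨H.e⟩
  have : SigmaFinite lam := hdoubling.sigmaFinite
  have hp0 : 0 < p := one_pos.trans hp
  have hq0 : 0 < q := by
    have h1 : α / N < 1 / p := by
      rw [lt_div_iff₀ hα] at hpN
      rw [div_lt_div_iff₀ (hα.trans hαN) hp0]
      linarith
    exact one_div_pos.1 (by linarith)
  have hpE : ENNReal.ofReal p ≠ 0 := (ENNReal.ofReal_pos.2 hp0).ne'
  have hqE : ENNReal.ofReal q ≠ 0 := (ENNReal.ofReal_pos.2 hq0).ne'
  set k := H.rieszKernel ρ N α with hk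
  have hkm : AEMeasurable k lam := Hypergroup.aemeasurable_rieszKernel hdoubling
  refine ⟨C ^ (1 / q), fun f hf => ?_⟩
  set g : K → ℝ := hf.1.mk f with hg
  have hgm : Measurable g := hf.1.measurable_mk
  have hφm : Measurable fun y => ‖g y‖₊ := hgm.nnnorm
  -- A Borel representative may replace `f` under the integral because the involution preserves null
  -- sets.
  have hfg : (fun y => f (H.inv y)) =ᵐ[lam] fun y => g (H.inv y) :=
    Measure.QuasiMeasurePreserving.ae_eq_comp ⟨H.inv.continuous.measurable,
      hlam.map_inv_absolutelyContinuous hcomm⟩ hf.1.ae_eq_mk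
  have hgi : Measurable fun y => g (H.inv y) := hgm.comp H.inv.continuous.measurable
  have hcongr : ∀ x, (fun y => (H.translate x k y).toReal * f (H.inv y)) =ᵐ[lam]
      fun y => (H.translate x k y).toReal * g (H.inv y) := fun x => by
    filter_upwards [hfg] with y hy
    rw [hy]
  -- Since `∞.toReal = 0`, the real kernel never exceeds the extended one, so this bound needs no
  -- finiteness.
  have hnorm : ∀ x, ∫⁻ y, ‖(H.translate x k y).toReal * g (H.inv y)‖ₑ ∂lam ≤
      H.lconv lam k (fun y => ‖g y‖₊) x := fun x => by
    refine lintegral_mono fun y => ?_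
    rw [enorm_mul, Real.enorm_of_nonneg ENNReal.toReal_nonneg]
    exact mul_le_mul_left ENNReal.ofReal_toReal_le _
  have hfp : ∫⁻ y, (‖g y‖₊ : ℝ≥0∞) ^ p ∂lam = eLpNorm f (ENNReal.ofReal p) lam ^ p := by
    rw [eLpNorm_congr_ae hf.1.ae_eq_mk, eLpNorm_eq_lintegral_rpow_enorm_toReal hpE
      ENNReal.ofReal_ne_top, ENNReal.toReal_ofReal hp0.le, ← ENNReal.rpow_mul,
      one_div_mul_cancel hp0.ne', ENNReal.rpow_one]
    rfl
  have hq : ∫⁻ x, H.lconv lam k (fun y => ‖g y‖₊) x ^ q ∂lam ≤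
      C * eLpNorm f (ENNReal.ofReal p) lam ^ q := by
    refine (hC _ hφm).trans_eq ?_
    rw [hfp, ← ENNReal.rpow_mul, mul_div_cancel₀ q hp0.ne']
  have hqfin : ∫⁻ x, H.lconv lam k (fun y => ‖g y‖₊) x ^ q ∂lam ≠ ∞ :=
    ne_top_of_le_ne_top (ENNReal.mul_ne_top ENNReal.coe_ne_top
      (ENNReal.rpow_ne_top_of_nonneg hq0.le hf.2.ne)) hq
  have hpot : ∀ x, H.rieszPotential ρ lam N α f x =
      ∫ y, (H.translate x k y).toReal * g (H.inv y) ∂lam := fun x =>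
    integral_congr_ae (hcongr x)
  have hmeas : AEStronglyMeasurable (H.rieszPotential ρ lam N α f) lam := by
    obtain ⟨h, hm, hh⟩ := hlam.exists_aemeasurable_prod_translate_ae hkm
    have h1 : AEStronglyMeasurable (fun x => ∫ y, (h (x, y)).toReal * g (H.inv y) ∂lam) lam :=
      (hm.ennreal_toReal.mul
        (hgi.comp measurable_snd).aemeasurable).aestronglyMeasurable.integral_prod_right'
    refine h1.congr (Eventually.of_forall fun x => ?_)
    rw [hpot]
    refine integral_congr_ae ?_
    filter_upwards [hh x] with y hy
    rw [hy]
  have hbound : eLpNorm (H.rieszPotential ρ lam N α f) (ENNReal.ofReal q) lam ≤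
      (C ^ (1 / q) : ℝ≥0) * eLpNorm f (ENNReal.ofReal p) lam := by
    rw [eLpNorm_eq_lintegral_rpow_enorm_toReal hqE ENNReal.ofReal_ne_top,
      ENNReal.toReal_ofReal hq0.le]
    calc (∫⁻ x, ‖H.rieszPotential ρ lam N α f x‖ₑ ^ q ∂lam) ^ (1 / q)
        ≤ (C * eLpNorm f (ENNReal.ofReal p) lam ^ q) ^ (1 / q) := by
          refine ENNReal.rpow_le_rpow (le_trans (lintegral_mono fun x => ?_) hq) (by positivity)
          refine ENNReal.rpow_le_rpow ?_ hq0.le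
          rw [hpot]
          exact (enorm_integral_le_lintegral_enorm _).trans (hnorm x)
      _ = _ := by
          rw [ENNReal.mul_rpow_of_nonneg _ _ (by positivity), ← ENNReal.rpow_mul,
            mul_one_div_cancel hq0.ne', ENNReal.rpow_one,
            ENNReal.coe_rpow_of_nonneg _ (by positivity)]
  refine ⟨?_, ⟨hmeas, hbound.trans_lt (ENNReal.mul_lt_top ENNReal.coe_lt_top hf.2)⟩, hbound⟩
  have hlm : AEMeasurable (H.lconv lam k fun y => ‖g y‖₊) lam :=
    hlam.aemeasurable_lconv hkm hφm.coe_nnreal_ennreal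
  filter_upwards [ae_lt_top' (hlm.pow_const q) hqfin] with x hx
  refine Integrable.congr ⟨((hlam.aemeasurable_translate hkm x).ennreal_toReal.mul
    hgi.aemeasurable).aestronglyMeasurable, (hnorm x).trans_lt ?_⟩ (hcongr x).symm
  exact (ENNReal.rpow_lt_top_iff_of_pos hq0).1 hx
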